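/- Let $N\ge 2$ be an integer. Let $e=(e_1,e_2,\dots)$ be the periodic sequence of period $N$ whose period is the list $L=(1,1,\dots,1,0)$ with $N-1$ ones. For $1\le k\le m$ a tuple $\zeta=(\zeta_1,\zeta_2,\dots)$ of non-negative integers is called a proper $L$-block with support interval $[k,m]$ if $\zeta_j=0$ for $j<k$ and for $j>m$, $\zeta_j=e_{m+1-j}$ for $k<j\le m$, and $\zeta_k<e_{m+1-k}$; the tuple $(e_m,e_{m-1},\dots,e_1,0,0,\dots)$, $m\ge1$, is called a maximal $L$-block with support interval $[1,m]$. The $N$-th order Zeckendorf collection $\mathcal E_N$ is the set of all sums of finitely many proper or maximal $L$-blocks with pairwise disjoint support intervals. (Equivalently, it is the set of all $0$-$1$ tuples of finite support that have no $N$ consecutive entries equal to $1$.) The base-$N$ expansion $n=\sum_{k\ge1}\mu_kN^{k-1}$, $0\le\mu_k<N$, of a non-negative integer $n$ is an $N$-th order Zeckendorf expression if $\mu\in\mathcal E_N$. For real $x$ let $z(x)$ be the number of non-negative integers $n<x$ whose base-$N$ expansion is an $N$-th order Zeckendorf expression. Let $f(x)=x^N-\sum_{k=0}^{N-1}x^k$,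 let $\phi$ be its dominant positive real zero, i.e. a positive zero whose modulus is larger than that of every other complex zero, and let $\gamma=\log_N\phi$. Put $$\alpha=\frac{f(2)}{(2-\phi)\,f'(\phi)},\qquad P=\frac{N^{N-1}-1}{(N-1)(N^N-1)N^{N-1}}.$$ Then $$\limsup_{x\to\infty}\frac{z(x)}{x^\gamma}=\frac{\alpha}{P^\gamma\phi^N},\qquad \liminf_{x\to\infty}\frac{z(x)}{x^\gamma}=\alpha,$$ both when $x$ runs through the real numbers and when $x$ runs through the positive integers. For $N=2$, $\phi$ is the golden ratio and these values are $$\frac{\alpha}{P^\gamma\phi^N}=\frac{\phi+2}{5}\,3^\gamma,\qquad \alpha=\frac{3\phi+1}{5}.$$ -/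

import Mathlib

open Filter Polynomial

/-!
Coefficient functions are maps `ℕ → ℕ`; the entry at `k` is the `(k + 1)`-st entry of the
infinite tuple `(μ₁, μ₂, …)`, so that it multiplies the `k`-th power of the base.
-/

/-- The periodic coefficient function `(e₁, …, e_N, e₁, …, e_N, …)` of a list `(e₁, …, e_N)`. -/
def periodicCoeff (L : List ℕ) (k : ℕ) : ℕ := L.getD (k % L.length) 0

/-- The reversal `(e_m, …, e₂, e₁, 0, 0, …)` of the first `m` entries of the periodic
coefficient function of `L`. -/
def maxCoeff (L : List ℕ) (m : ℕ) (k : ℕ) : ℕ :=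
  if k < m then periodicCoeff L (m - 1 - k) else 0

/-- `ζ` is a proper `L`-block whose support interval is the set of positions `a, a + 1, …, b`:
above `a` it agrees with the reversed periodic coefficient function of length `b + 1`, at `a` it is
smaller, and below `a` it vanishes. -/
def IsProperBlock (L : List ℕ) (ζ : ℕ → ℕ) (a b : ℕ) : Prop :=
  a ≤ b ∧ (∀ k, a < k → ζ k = maxCoeff L (b + 1) k) ∧ ζ a < maxCoeff L (b + 1) a ∧
    ∀ k, k < a → ζ k = 0

/-- `ζ` is a maximal `L`-block; its support interval is the set of positions `0, 1, …, b`. -/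
def IsMaximalBlock (L : List ℕ) (ζ : ℕ → ℕ) (a b : ℕ) : Prop :=
  a = 0 ∧ ζ = maxCoeff L (b + 1)

/-- `ζ` is an `L`-block with support interval `[a, b]`. -/
def IsBlock (L : List ℕ) (ζ : ℕ → ℕ) (a b : ℕ) : Prop :=
  IsProperBlock L ζ a b ∨ IsMaximalBlock L ζ a b

/-- The periodic Zeckendorf collection determined by `L`: all sums of finitely many `L`-blocks
with pairwise disjoint support intervals. -/
def periodicCollection (L : List ℕ) : Set (ℕ → ℕ) :=
  {ε | ∃ (r : ℕ) (ζ : Fin r → ℕ → ℕ) (a b : Fin r → ℕ),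
    (∀ i, IsBlock L (ζ i) (a i) (b i)) ∧
    (∀ i j, i ≠ j → Disjoint (Set.Icc (a i) (b i)) (Set.Icc (a j) (b j))) ∧
    ε = ∑ i, ζ i}

/-- The `N`-th order Zeckendorf collection, determined by `(1, …, 1, 0)` with `N - 1` ones. -/
def zeckendorfCollection (N : ℕ) : Set (ℕ → ℕ) :=
  periodicCollection (List.replicate (N - 1) 1 ++ [0])

/-- The coefficient function of the base-`N` expansion of `n`: the entry at `k` is the digit
of `N ^ k`. -/
def baseDigits (N n : ℕ) (k : ℕ) : ℕ := (Nat.digits N n).getD k 0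

/-- `z(x)`: the number of non-negative integers `n < x` whose base-`N` expansion is an `N`-th order
Zeckendorf expression. -/
noncomputable def zeckendorfCount (N : ℕ) (x : ℝ) : ℕ :=
  Set.ncard {n : ℕ | (n : ℝ) < x ∧ baseDigits N n ∈ zeckendorfCollection N}

/-- The polynomial `x ^ N - ∑_{k < N} x ^ k`. -/
noncomputable def nStepPoly (N : ℕ) : ℝ[X] := X ^ N - ∑ k ∈ Finset.range N, X ^ k

/-- `φ` is the dominant positive real zero of `f`: a positive zero whose modulus exceeds that of
every other complex zero. -/
def IsDominantZero (f : ℝ[X]) (φ : ℝ) : Prop :=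
  0 < φ ∧ f.eval φ = 0 ∧ ∀ w : ℂ, aeval w f = 0 → w ≠ (φ : ℂ) → ‖w‖ < φ

/-! Zeckendorf expressions correspond to finite sets `s` of positions without `N` consecutive
elements, with value `T = ∑ k ∈ s, N ^ k`. Values are ordered like the sets in colex order, so the
number of expressions below that of `s` is `∑ k ∈ s, H k`, where `H k` counts the run-free subsets
of `{0, …, k - 1}` (`ncard_noRun_lt`). These counts satisfy the `N`-step recurrence with `H k = 2 ^
k` for `k < N`, whence `H k ~ α * φ ^ k` (`tendsto_nStep_div_pow`).

Up to lower-order terms, `z(x) / x ^ γ` is therefore `α * ∑ k ∈ s, φ ^ k` divided by `T ^ γ`, and `φ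
^ k = (N ^ k) ^ γ`. Subadditivity of `t ^ γ` bounds the ratio below by `α` (`rpow_sum_pow_le`),
attained at `x = N ^ m`. The upper bound is `∑ k ∈ s, φ ^ k ≤ (T / b) ^ γ` with `b = maxFraction N =
P * N ^ N` (`NoRun.sum_pow_root_le`). It is asymptotically sharp just above the largest run-free
value below `N ^ m`, which is about `b * N ^ m`.

For the sharp bound, normalise by the top position `m`: let `S = T / (b * N ^ (m + 1))`. A potential
argument over the runs of `s` gives `(∑ k ∈ s, φ ^ k) / φ ^ (m + 1) ≤ 1 - c * (1 - S)`, and for a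
suitable `c` this line through `(1, 1)` lies below `S ^ γ` on the relevant interval. -/

/-! ### Gaps and top runs of finite sets. -/

/-- `s` contains no `N` consecutive natural numbers. -/
def NoRun (N : ℕ) (s : Finset ℕ) : Prop := ∀ p, ∃ i < N, p + i ∉ s

/-- The `0`-`1` coefficient function of a finite set of positions. -/
def digitIndicator (s : Finset ℕ) (k : ℕ) : ℕ := if k ∈ s then 1 else 0

theorem NoRun.subset {N : ℕ} {s t : Finset ℕ} (ht : NoRun N t) (h : s ⊆ t) : NoRun N s := by
  intro p
  obtain ⟨i, hi, hp⟩ := ht p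
  exact ⟨i, hi, fun hs => hp (h hs)⟩

theorem noRun_empty {N : ℕ} (hN : 0 < N) : NoRun N ∅ := fun _ => ⟨0, hN, by simp⟩

/-- Splitting at a missing position preserves the absence of runs. -/
theorem NoRun.union_of_gap {N q : ℕ} {s t : Finset ℕ} (hs : NoRun N s) (ht : NoRun N t)
    (hsq : ∀ k ∈ s, k < q) (htq : ∀ k ∈ t, q < k) : NoRun N (s ∪ t) := by
  intro p
  rcases lt_or_ge q p with hp | hp
  · obtain ⟨i, hi, hpi⟩ := ht p
    refine ⟨i, hi, fun h => ?_⟩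
    rcases Finset.mem_union.1 h with h | h
    · have := hsq _ h; omega
    · exact hpi h
  · rcases lt_or_ge q (p + N) with hq | hq
    · refine ⟨q - p, by omega, fun h => ?_⟩
      rw [Nat.add_sub_cancel' hp] at h
      rcases Finset.mem_union.1 h with h | h
      · exact (hsq _ h).false
      · exact (htq _ h).false
    · obtain ⟨i, hi, hpi⟩ := hs p
      refine ⟨i, hi, fun h => ?_⟩
      rcases Finset.mem_union.1 h with h | h
      · exact hpi h
      · have := htq _ h; omega

theorem noRun_of_card_lt {N : ℕ} {s : Finset ℕ} (h : s.card < N) : NoRun N s := by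
  intro p
  by_contra! hc
  have : (Finset.Ico p (p + N)) ⊆ s := by
    intro k hk
    rw [Finset.mem_Ico] at hk
    have := hc (k - p) (by omega)
    rwa [Nat.add_sub_cancel' hk.1] at this
  have := Finset.card_le_card this
  rw [Nat.card_Ico] at this
  omega

/-- The decomposition of a set without runs at its largest gap below `m`. -/
theorem NoRun.exists_top_run {N m : ℕ} {s : Finset ℕ} (hs : NoRun N s)
    (hm : s ⊆ Finset.range m) :
    (m < N ∧ s = Finset.range m) ∨
    ∃ q i, i < N ∧ m = q + i + 1 ∧ q ∉ s ∧
      s = s.filter (· < q) ∪ Finset.Ico (q + 1) (q + 1 + i) := by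
  by_cases h : Finset.range m ⊆ s
  · left
    have hsm := hm.antisymm h
    refine ⟨?_, hsm⟩
    obtain ⟨i, hi, h0⟩ := hs 0
    by_contra! hc
    exact h0 (h (Finset.mem_range.2 (by omega)))
  · right
    have hne : (Finset.range m \ s).Nonempty := by
      rwa [Finset.sdiff_nonempty]
    set q := (Finset.range m \ s).max' hne with hq
    have hqm := Finset.max'_mem _ hne
    rw [← hq, Finset.mem_sdiff, Finset.mem_range] at hqm
    have htop : ∀ k, q < k → k < m → k ∈ s := by
      intro k hk hkm
      by_contra hks
      have := Finset.le_max' (Finset.range m \ s) k (by simp [hks, hkm])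
      omega
    refine ⟨q, m - 1 - q, ?_, by omega, hqm.2, ?_⟩
    · obtain ⟨i, hi, hp⟩ := hs (q + 1)
      by_contra! hc
      exact hp (htop _ (by omega) (by omega))
    · ext k
      simp only [Finset.mem_union, Finset.mem_filter, Finset.mem_Ico]
      constructor
      · intro hk
        have := Finset.mem_range.1 (hm hk)
        have : k ≠ q := fun h => hqm.2 (h ▸ hk)
        by_cases hkq : k < q
        · exact Or.inl ⟨hk, hkq⟩
        · right; omega
      · rintro (h | h)
        · exact h.1
        · exact htop _ (by omega) (by omega)

/-! ### Counting and ranking sets without long runs. -/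

open Classical in
/-- The subsets of `{0, …, m - 1}` without `N` consecutive elements. -/
noncomputable def noRunSets (N m : ℕ) : Finset (Finset ℕ) :=
  (Finset.range m).powerset.filter (NoRun N)

theorem mem_noRunSets {N m : ℕ} {s : Finset ℕ} :
    s ∈ noRunSets N m ↔ s ⊆ Finset.range m ∧ NoRun N s := by
  simp [noRunSets]

theorem card_noRunSets_of_lt {N m : ℕ} (h : m < N) : (noRunSets N m).card = 2 ^ m := by
  have : noRunSets N m = (Finset.range m).powerset := by
    ext s
    rw [mem_noRunSets, Finset.mem_powerset]
    refine ⟨fun h => h.1, fun hs => ⟨hs, noRun_of_card_lt ?_⟩⟩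
    have := Finset.card_le_card hs
    rw [Finset.card_range] at this
    omega
  rw [this, Finset.card_powerset, Finset.card_range]

/-- Classify by the largest gap, which must be `m + i` with `i < N`: everything above it is full,
and below it any run-free set is allowed. -/
theorem card_noRunSets_add (N m : ℕ) :
    (noRunSets N (m + N)).card = ∑ i ∈ Finset.range N, (noRunSets N (m + i)).card := by
  classical
  have key : noRunSets N (m + N) = (Finset.range N).biUnion (fun i =>
      (noRunSets N (m + i)).image (· ∪ Finset.Ico (m + i + 1) (m + N))) := by
    ext s
    simp only [Finset.mem_biUnion, Finset.mem_range, Finset.mem_image, mem_noRunSets]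
    constructor
    · rintro ⟨hsm, hs⟩
      rcases hs.exists_top_run hsm with ⟨h, -⟩ | ⟨q, i, hi, hm, hq, hsq⟩
      · omega
      · refine ⟨q - m, by omega, s.filter (· < q), ⟨?_, hs.subset (Finset.filter_subset _ _)⟩, ?_⟩
        · intro k hk
          simp only [Finset.mem_filter, Finset.mem_range] at hk ⊢
          omega
        · conv_rhs => rw [hsq]
          congr 2 <;> omega
    · rintro ⟨i, hi, u, ⟨hu, hu'⟩, rfl⟩
      have hu2 : ∀ k ∈ u, k < m + i := fun k hk => Finset.mem_range.1 (hu hk)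
      refine ⟨?_, ?_⟩
      · intro k hk
        simp only [Finset.mem_union, Finset.mem_Ico, Finset.mem_range] at hk ⊢
        rcases hk with hk | hk
        · have := hu2 k hk; omega
        · omega
      · refine hu'.union_of_gap (q := m + i) (noRun_of_card_lt ?_) hu2 ?_
        · rw [Nat.card_Ico]; omega
        · intro k hk
          rw [Finset.mem_Ico] at hk; omega
  have gap : ∀ i < N, ∀ s ∈ (noRunSets N (m + i)).image (· ∪ Finset.Ico (m + i + 1) (m + N)),
      m + i ∉ s ∧ ∀ k, m + i < k → k < m + N → k ∈ s := by
    intro i _ s hs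
    rw [Finset.mem_image] at hs
    obtain ⟨u, hu, rfl⟩ := hs
    have hu2 : ∀ k ∈ u, k < m + i := fun k hk => Finset.mem_range.1 ((mem_noRunSets.1 hu).1 hk)
    refine ⟨fun h => ?_, fun k h1 h2 => ?_⟩
    · simp only [Finset.mem_union, Finset.mem_Ico] at h
      rcases h with h | h
      · exact (hu2 _ h).false
      · omega
    · simp only [Finset.mem_union, Finset.mem_Ico]
      right; omega
  rw [key, Finset.card_biUnion]
  · refine Finset.sum_congr rfl fun i _ => Finset.card_image_of_injOn ?_
    intro u hu v hv huv
    have hu2 : ∀ k ∈ u, k < m + i := fun k hk => Finset.mem_range.1 ((mem_noRunSets.1 hu).1 hk)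
    have hv2 : ∀ k ∈ v, k < m + i := fun k hk => Finset.mem_range.1 ((mem_noRunSets.1 hv).1 hk)
    ext k
    have := congrArg (k ∈ ·) huv
    simp only [Finset.mem_union, Finset.mem_Ico, eq_iff_iff] at this
    constructor
    · intro hk
      have := this.1 (Or.inl hk)
      have := hu2 k hk
      rcases ‹k ∈ v ∨ _› with h | h
      · exact h
      · omega
    · intro hk
      have := this.2 (Or.inl hk)
      have := hv2 k hk
      rcases ‹k ∈ u ∨ _› with h | h
      · exact h
      · omega
  · intro i hi j hj hij
    rw [Function.onFun, Finset.disjoint_left]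
    intro s hsi hsj
    have hi' := Finset.mem_range.1 hi
    have hj' := Finset.mem_range.1 hj
    obtain ⟨h1, h2⟩ := gap i hi' s hsi
    obtain ⟨h3, h4⟩ := gap j hj' s hsj
    rcases lt_or_gt_of_ne hij with h | h
    · exact h3 (h2 _ (by omega) (by omega))
    · exact h1 (h4 _ (by omega) (by omega))

/-- The rank of a set without runs, in the order of the numbers with these digits. -/
theorem ncard_noRun_lt {N : ℕ} (hN : 2 ≤ N) {s : Finset ℕ} (hs : NoRun N s) :
    Set.ncard {t : Finset ℕ | NoRun N t ∧ ∑ k ∈ t, N ^ k < ∑ k ∈ s, N ^ k}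
      = ∑ k ∈ s, (noRunSets N k).card := by
  classical
  have key : {t : Finset ℕ | NoRun N t ∧ ∑ k ∈ t, N ^ k < ∑ k ∈ s, N ^ k} =
      ((s.biUnion fun k => (noRunSets N k).image (· ∪ s.filter (k < ·)) : Finset (Finset ℕ)) :
        Set (Finset ℕ)) := by
    ext t
    simp only [Set.mem_ofPred_eq, Finset.coe_biUnion, Set.mem_iUnion, Finset.mem_coe,
      Finset.mem_image, mem_noRunSets, exists_prop]
    -- In colex order, `t < s` is decided at the largest differing position `k`, which lies in `s`
    -- but not in `t`. Above `k` the sets agree; below it `t` is any run-free set, because the gap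
    -- at `k` separates the two parts.
    rw [Finset.geomSum_lt_geomSum_iff_toColex_lt_toColex hN,
      Finset.Colex.lt_iff_exists_filter_lt]
    simp only [Finset.mem_sdiff]
    constructor
    · rintro ⟨ht, k, ⟨hks, hkt⟩, hf⟩
      refine ⟨k, hks, t.filter (· < k), ⟨?_, ht.subset (Finset.filter_subset _ _)⟩, ?_⟩
      · intro j hj
        exact Finset.mem_range.2 (Finset.mem_filter.1 hj).2
      · rw [← hf]
        ext j
        simp only [Finset.mem_union, Finset.mem_filter]
        constructor
        · rintro (h | h) <;> exact h.1
        · intro h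
          rcases lt_trichotomy j k with h' | rfl | h'
          · exact Or.inl ⟨h, h'⟩
          · exact absurd h hkt
          · exact Or.inr ⟨h, h'⟩
    · rintro ⟨k, hks, u, ⟨hu, hu'⟩, rfl⟩
      have hu2 : ∀ j ∈ u, j < k := fun j hj => Finset.mem_range.1 (hu hj)
      refine ⟨hu'.union_of_gap (hs.subset (Finset.filter_subset _ _)) hu2
        (fun j hj => (Finset.mem_filter.1 hj).2), k, ⟨hks, fun h => ?_⟩, ?_⟩
      · rcases Finset.mem_union.1 h with h | h
        · exact (hu2 _ h).false
        · exact (Finset.mem_filter.1 h).2.false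
      · ext j
        simp only [Finset.mem_union, Finset.mem_filter]
        constructor
        · rintro ⟨h | h, hj⟩
          · have := hu2 j h; omega
          · exact ⟨h.1, hj⟩
        · intro h
          exact ⟨Or.inr h, h.2⟩
  have gap : ∀ k, ∀ t ∈ (noRunSets N k).image (· ∪ s.filter (k < ·)),
      k ∉ t ∧ ∀ j, k < j → j ∈ s → j ∈ t := by
    intro k t ht
    rw [Finset.mem_image] at ht
    obtain ⟨u, hu, rfl⟩ := ht
    have hu2 : ∀ j ∈ u, j < k := fun j hj => Finset.mem_range.1 ((mem_noRunSets.1 hu).1 hj)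
    refine ⟨fun h => ?_, fun j h1 h2 => ?_⟩
    · rcases Finset.mem_union.1 h with h | h
      · exact (hu2 _ h).false
      · exact (Finset.mem_filter.1 h).2.false
    · exact Finset.mem_union_right _ (Finset.mem_filter.2 ⟨h2, h1⟩)
  rw [key, Set.ncard_coe_finset, Finset.card_biUnion]
  · refine Finset.sum_congr rfl fun k _ => Finset.card_image_of_injOn ?_
    intro u hu v hv huv
    have hu2 : ∀ j ∈ u, j < k := fun j hj => Finset.mem_range.1 ((mem_noRunSets.1 hu).1 hj)
    have hv2 : ∀ j ∈ v, j < k := fun j hj => Finset.mem_range.1 ((mem_noRunSets.1 hv).1 hj)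
    have aux : ∀ w : Finset ℕ, (∀ j ∈ w, j < k) →
        (w ∪ s.filter (k < ·)).filter (· < k) = w := by
      intro w hw
      ext j
      simp only [Finset.mem_filter, Finset.mem_union]
      constructor
      · rintro ⟨h | h, hj⟩
        · exact h
        · omega
      · exact fun h => ⟨Or.inl h, hw j h⟩
    rw [← aux u hu2, ← aux v hv2]
    exact congrArg _ huv
  · intro i hi j hj hij
    rw [Function.onFun, Finset.disjoint_left]
    intro t hti htj
    obtain ⟨h1, h2⟩ := gap i t hti
    obtain ⟨h3, h4⟩ := gap j t htj
    rcases lt_or_gt_of_ne hij with h | h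
    · exact h3 (h2 j h hj)
    · exact h1 (h4 i h hi)

/-! ### Blocks and run-free sets. -/

/-- The list `(1, …, 1, 0)` with `N - 1` ones. -/
abbrev onesZero (N : ℕ) : List ℕ := List.replicate (N - 1) 1 ++ [0]

theorem periodicCoeff_onesZero {N : ℕ} (hN : 0 < N) (k : ℕ) :
    periodicCoeff (onesZero N) k = if k % N = N - 1 then 0 else 1 := by
  have hlen : (onesZero N).length = N := by simp; omega
  have hk := Nat.mod_lt k hN
  rw [periodicCoeff, hlen]
  split_ifs with h
  · rw [h, List.getD_append_right] <;> simp
  · rw [List.getD_append _ _ _ _ (by simp; omega), List.getD_eq_getElem _ _ (by simp; omega)]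
    simp

theorem maxCoeff_onesZero_le_one {N : ℕ} (hN : 0 < N) (m k : ℕ) :
    maxCoeff (onesZero N) m k ≤ 1 := by
  rw [maxCoeff, periodicCoeff_onesZero hN]
  split_ifs <;> omega

/-- The zeros recur with period `N` counted down from the top, so a window of length `N` either
meets one of them or reaches past the top, where entries vanish by default. -/
theorem maxCoeff_onesZero_exists_eq_zero {N : ℕ} (hN : 0 < N) (m p : ℕ) :
    ∃ i < N, maxCoeff (onesZero N) m (p + i) = 0 := by
  by_cases h : m < p + N
  · by_cases hm : p < m
    · exact ⟨m - p, by omega, by simp [maxCoeff]; omega⟩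
    · exact ⟨0, hN, by simp [maxCoeff, hm]⟩
  · set d := m - p - N with hd
    refine ⟨d % N, Nat.mod_lt _ hN, ?_⟩
    have h1 := Nat.mod_lt d hN
    have h2 := Nat.div_add_mod d N
    have h3 : m - 1 - (p + d % N) = N - 1 + N * (d / N) := by omega
    have h4 : (m - 1 - (p + d % N)) % N = N - 1 := by
      rw [h3, Nat.add_mul_mod_self_left, Nat.mod_eq_of_lt (by omega)]
    rw [maxCoeff, periodicCoeff_onesZero hN, h4]
    simp

theorem IsBlock.eq_zero_of_notMem {N : ℕ} {ζ : ℕ → ℕ} {a b k : ℕ}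
    (h : IsBlock (onesZero N) ζ a b) (hk : k ∉ Set.Icc a b) : ζ k = 0 := by
  rw [Set.mem_Icc, not_and_or, not_le, not_le] at hk
  rcases h with ⟨_, h1, _, h2⟩ | ⟨h1, h2⟩
  · rcases hk with hk | hk
    · exact h2 k hk
    · rw [h1 k (by omega), maxCoeff, if_neg (by omega)]
  · rw [h2, maxCoeff, if_neg (by omega)]

theorem IsBlock.le_maxCoeff {N : ℕ} {ζ : ℕ → ℕ} {a b : ℕ}
    (h : IsBlock (onesZero N) ζ a b) (k : ℕ) : ζ k ≤ maxCoeff (onesZero N) (b + 1) k := by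
  rcases h with ⟨_, h1, h2, h3⟩ | ⟨h1, h2⟩
  · rcases lt_trichotomy k a with hk | rfl | hk
    · rw [h3 k hk]; exact Nat.zero_le _
    · exact h2.le
    · rw [h1 k hk]
  · rw [h2]

/-- The bottom entry of a block can be positive only if the support starts at `0`. -/
theorem IsBlock.bottom_eq_zero {N : ℕ} (hN : 0 < N) {ζ : ℕ → ℕ} {a b : ℕ}
    (h : IsBlock (onesZero N) ζ a b) (ha : a ≠ 0) : ζ a = 0 := by
  rcases h with ⟨_, _, h2, _⟩ | ⟨h1, _⟩
  · have := maxCoeff_onesZero_le_one hN (b + 1) a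
    omega
  · exact absurd h1 ha

/-- A run of `N` ones cannot stay inside one block, which lies below a maximal pattern. It cannot
cross into the next block either: that one starts at a positive position, so its bottom entry is
`0`. -/
theorem exists_noRun_of_mem_zeckendorfCollection {N : ℕ} (hN : 0 < N) {ε : ℕ → ℕ}
    (h : ε ∈ zeckendorfCollection N) : ∃ s, NoRun N s ∧ ε = digitIndicator s := by
  classical
  obtain ⟨r, ζ, a, b, hb, hd, rfl⟩ := h
  -- the sum has at most one nonzero term at each position
  have hval : ∀ i k, k ∈ Set.Icc (a i) (b i) → (∑ j, ζ j) k = ζ i k := by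
    intro i k hk
    rw [Finset.sum_apply]
    refine Finset.sum_eq_single_of_mem i (Finset.mem_univ _) fun j _ hj => ?_
    exact (hb j).eq_zero_of_notMem fun hkj => Set.disjoint_left.1 (hd j i hj) hkj hk
  have hin : ∀ k, (∑ j, ζ j) k ≠ 0 → ∃ i, k ∈ Set.Icc (a i) (b i) := by
    intro k hk
    by_contra! hc
    exact hk (by
      rw [Finset.sum_apply]
      exact Finset.sum_eq_zero fun j _ => (hb j).eq_zero_of_notMem (hc j))
  have hle : ∀ k, (∑ j, ζ j) k ≤ 1 := by
    intro k
    by_cases hk : (∑ j, ζ j) k = 0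
    · omega
    · obtain ⟨i, hi⟩ := hin k hk
      rw [hval i k hi]
      exact ((hb i).le_maxCoeff k).trans (maxCoeff_onesZero_le_one hN _ _)
  set B := Finset.univ.sup b with hB
  refine ⟨(Finset.range (B + 1)).filter (fun k => (∑ j, ζ j) k ≠ 0), ?_, ?_⟩
  · intro p
    by_contra! hc
    have hone : ∀ i < N, (∑ j, ζ j) (p + i) ≠ 0 := fun i hi => (Finset.mem_filter.1 (hc i hi)).2
    obtain ⟨i, hi⟩ := hin p (hone 0 hN)
    by_cases hbi : p + N ≤ b i + 1
    · obtain ⟨l, hl, hz⟩ := maxCoeff_onesZero_exists_eq_zero hN (b i + 1) p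
      have := (hb i).le_maxCoeff (p + l)
      refine hone l hl ?_
      rw [hval i (p + l) ⟨by have := hi.1; omega, by omega⟩]
      omega
    · have hpb := hi.2
      have hne := hone (b i + 1 - p) (by omega)
      rw [show p + (b i + 1 - p) = b i + 1 by omega] at hne
      obtain ⟨j, hj⟩ := hin _ hne
      have hij : i ≠ j := by
        rintro rfl
        have := hj.2; omega
      have haj : a j = b i + 1 := by
        by_contra hne'
        have h1 := hj.1
        have h2 := hj.2
        exact Set.disjoint_left.1 (hd i j hij)
          (show b i ∈ Set.Icc (a i) (b i) from ⟨hi.1.trans hi.2, le_rfl⟩) ⟨by omega, by omega⟩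
      refine hne ?_
      rw [hval j _ hj, ← haj]
      exact (hb j).bottom_eq_zero hN (by omega)
  · funext k
    rw [digitIndicator]
    have hk := hle k
    split_ifs with h
    · have := (Finset.mem_filter.1 h).2
      omega
    · by_contra hne
      refine h (Finset.mem_filter.2 ⟨?_, hne⟩)
      obtain ⟨i, hi⟩ := hin k hne
      have := Finset.le_sup (f := b) (Finset.mem_univ i)
      have := hi.2
      rw [Finset.mem_range]; omega

/-- Greedy decomposition from the top: compare the digits with the maximal pattern of length `m`.
Full agreement gives a maximal block; otherwise the highest disagreement `q` closes a proper block
(possibly the zero block on `{q}`), and the rest lies below `q`. -/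
theorem exists_blocks_of_noRun {N : ℕ} (hN : 0 < N) (m : ℕ) :
    ∀ s : Finset ℕ, s ⊆ Finset.range m → NoRun N s →
      ∃ (r : ℕ) (ζ : Fin r → ℕ → ℕ) (a b : Fin r → ℕ),
        (∀ i, IsBlock (onesZero N) (ζ i) (a i) (b i)) ∧
        (∀ i j, i ≠ j → Disjoint (Set.Icc (a i) (b i)) (Set.Icc (a j) (b j))) ∧
        digitIndicator s = ∑ i, ζ i ∧ ∀ i, b i < m := by
  classical
  induction m using Nat.strong_induction_on with
  | _ m ih =>
  intro s hsm hs
  rcases Nat.eq_zero_or_pos m with rfl | hm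
  · refine ⟨0, Fin.elim0, Fin.elim0, Fin.elim0, fun i => i.elim0, fun i => i.elim0, ?_,
      fun i => i.elim0⟩
    have : s = ∅ := by simpa using hsm
    subst this
    funext k
    simp [digitIndicator]
  by_cases hmax : ∀ k < m, digitIndicator s k = maxCoeff (onesZero N) m k
  · refine ⟨1, fun _ => maxCoeff (onesZero N) m, fun _ => 0, fun _ => m - 1, fun i => ?_, ?_, ?_,
      fun i => by dsimp only; omega⟩
    · right
      exact ⟨rfl, by rw [Nat.sub_add_cancel hm]⟩
    · intro i j hij
      exact absurd (Subsingleton.elim i j) hij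
    · rw [Fin.sum_univ_one]
      funext k
      by_cases hk : k < m
      · exact hmax k hk
      · have : k ∉ s := fun h => hk (Finset.mem_range.1 (hsm h))
        simp [digitIndicator, this, maxCoeff, hk]
  · push Not at hmax
    set D := (Finset.range m).filter
      (fun k => digitIndicator s k ≠ maxCoeff (onesZero N) m k) with hD
    have hne : D.Nonempty := by
      obtain ⟨k, hk, hk'⟩ := hmax
      exact ⟨k, Finset.mem_filter.2 ⟨Finset.mem_range.2 hk, hk'⟩⟩
    set q := D.max' hne with hq
    obtain ⟨hqm, hqne⟩ := Finset.mem_filter.1 (D.max'_mem hne)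
    rw [← hq, Finset.mem_range] at hqm
    rw [← hq] at hqne
    have htop : ∀ k, q < k → k < m → digitIndicator s k = maxCoeff (onesZero N) m k := by
      intro k hk hkm
      by_contra hc
      have := D.le_max' k (Finset.mem_filter.2 ⟨Finset.mem_range.2 hkm, hc⟩)
      omega
    -- If `q ∈ s`, the pattern would have its `0` at `q`, hence ones at the `N - 1` positions above;
    -- agreement there would give `s` a run of length `N`.
    have hqs : q ∉ s := by
      intro hqs
      have h1 : maxCoeff (onesZero N) m q = 0 := by
        have := maxCoeff_onesZero_le_one hN m q
        simp only [digitIndicator, hqs, if_true] at hqne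
        omega
      have h2 : (m - 1 - q) % N = N - 1 := by
        rw [maxCoeff, if_pos hqm, periodicCoeff_onesZero hN] at h1
        by_contra hc
        simp [hc] at h1
      obtain ⟨i, hi, hqi⟩ := hs q
      have hi0 : i ≠ 0 := by
        rintro rfl
        exact hqi hqs
      have hmod := Nat.mod_le (m - 1 - q) N
      have h3 := htop (q + i) (by omega) (by omega)
      rw [maxCoeff, if_pos (by omega), periodicCoeff_onesZero hN] at h3
      have h4 : (m - 1 - (q + i)) % N = N - 1 - i := by
        have h5 := Nat.div_add_mod (m - 1 - q) N
        have : m - 1 - (q + i) = N - 1 - i + N * ((m - 1 - q) / N) := by omega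
        rw [this, Nat.add_mul_mod_self_left, Nat.mod_eq_of_lt (by omega)]
      rw [h4, if_neg (by omega)] at h3
      simp [digitIndicator, hqi] at h3
    have hq1 : maxCoeff (onesZero N) m q ≠ 0 := by
      simpa [digitIndicator, hqs, eq_comm] using hqne
    obtain ⟨r, ζ, a, b, hb, hd, hsum, hbq⟩ := ih q hqm (s.filter (· < q))
      (fun k hk => Finset.mem_range.2 (Finset.mem_filter.1 hk).2)
      (hs.subset (Finset.filter_subset _ _))
    refine ⟨r + 1, Fin.cons (digitIndicator (s.filter (q < ·))) ζ, Fin.cons q a,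
      Fin.cons (m - 1) b, ?_, ?_, ?_, ?_⟩
    · refine Fin.cases ?_ fun i => ?_
      · left
        simp only [Fin.cons_zero]
        rw [IsProperBlock, Nat.sub_add_cancel hm]
        refine ⟨by omega, fun k hk => ?_, ?_, fun k hk => ?_⟩
        · by_cases hkm : k < m
          · rw [← htop k hk hkm]
            simp [digitIndicator, hk]
          · have : k ∉ s := fun h => hkm (Finset.mem_range.1 (hsm h))
            simp [digitIndicator, this, maxCoeff, hkm]
        · have : digitIndicator (s.filter (q < ·)) q = 0 := by simp [digitIndicator]
          omega
        · simp [digitIndicator, hk.le]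
      · simpa using hb i
    · have h0 : ∀ i, Disjoint (Set.Icc q (m - 1)) (Set.Icc (a i) (b i)) := by
        intro i
        rw [Set.disjoint_left]
        intro k h1 h2
        have := hbq i
        have := h1.1
        have := h2.2
        omega
      refine Fin.cases ?_ fun i => ?_
      · refine Fin.cases (fun h => absurd rfl h) fun j _ => ?_
        simpa using h0 j
      · refine Fin.cases (fun _ => ?_) fun j hij => ?_
        · simpa using (h0 i).symm
        · simpa using hd i j (fun h => hij (congrArg Fin.succ h))
    · rw [Fin.sum_univ_succ]
      simp only [Fin.cons_zero, Fin.cons_succ]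
      rw [← hsum]
      funext k
      simp only [digitIndicator, Pi.add_apply, Finset.mem_filter]
      rcases lt_trichotomy k q with h | rfl | h
      · simp [h, h.le]
      · simp [hqs]
      · simp [h, h.le]
    · refine Fin.cases ?_ fun i => ?_
      · simp only [Fin.cons_zero]; omega
      · simp only [Fin.cons_succ]
        exact (hbq i).trans hqm

/-- The Zeckendorf collection consists of the `0`-`1` tuples of finite support without `N`
consecutive ones. -/
theorem mem_zeckendorfCollection_iff {N : ℕ} (hN : 0 < N) {ε : ℕ → ℕ} :
    ε ∈ zeckendorfCollection N ↔ ∃ s, NoRun N s ∧ ε = digitIndicator s := by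
  refine ⟨exists_noRun_of_mem_zeckendorfCollection hN, ?_⟩
  rintro ⟨s, hs, rfl⟩
  obtain ⟨r, ζ, a, b, h1, h2, h3, -⟩ := exists_blocks_of_noRun hN (s.sup id + 1) s
    (fun k hk => Finset.mem_range.2 (Nat.lt_succ_of_le (Finset.le_sup (f := id) hk))) hs
  exact ⟨r, ζ, a, b, h1, h2, h3⟩

/-! ### Base-`N` values and the counting function. -/

theorem baseDigits_eq {N : ℕ} (hN : 2 ≤ N) (n k : ℕ) : baseDigits N n k = n / N ^ k % N :=
  Nat.getD_digits n k hN

theorem baseDigits_injective {N : ℕ} (hN : 2 ≤ N) : Function.Injective (baseDigits N) := by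
  intro a b hab
  have h : ∀ k, a % N ^ k = b % N ^ k := by
    intro k
    induction k with
    | zero => simp [Nat.mod_one]
    | succ k ih =>
      rw [Nat.mod_pow_succ, Nat.mod_pow_succ, ih, ← baseDigits_eq hN, ← baseDigits_eq hN, hab]
  -- The exponent `a + b` makes the modulus exceed both numbers.
  have := h (a + b)
  have hlt := Nat.lt_pow_self (n := a + b) (a := N) (by omega)
  rwa [Nat.mod_eq_of_lt (by omega), Nat.mod_eq_of_lt (by omega)] at this

theorem baseDigits_sum_pow {N : ℕ} (hN : 2 ≤ N) (s : Finset ℕ) :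
    baseDigits N (∑ k ∈ s, N ^ k) = digitIndicator s := by
  funext k
  rw [baseDigits_eq hN]
  have hlow : ∑ j ∈ s.filter (· < k), N ^ j < N ^ k :=
    Nat.geomSum_lt hN fun j hj => (Finset.mem_filter.1 hj).2
  have hsplit : s = s.filter (· < k) ∪ (s.filter (· = k) ∪ s.filter (k < ·)) := by
    ext j
    simp only [Finset.mem_union, Finset.mem_filter]
    have := lt_trichotomy j k
    tauto
  have hhigh : N ^ (k + 1) ∣ ∑ j ∈ s.filter (k < ·), N ^ j :=
    Finset.dvd_sum fun j hj => pow_dvd_pow N (Finset.mem_filter.1 hj).2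
  obtain ⟨c, hc⟩ := hhigh
  have hmid : ∑ j ∈ s.filter (· = k), N ^ j = N ^ k * digitIndicator s k := by
    rw [Finset.filter_eq', digitIndicator]
    split_ifs <;> simp
  have hsum : ∑ j ∈ s, N ^ j
      = ∑ j ∈ s.filter (· < k), N ^ j + N ^ k * (digitIndicator s k + N * c) := by
    conv_lhs => rw [hsplit]
    rw [Finset.sum_union, Finset.sum_union, hc, hmid]
    · ring
    · rw [Finset.disjoint_left]
      intro j h1 h2
      have := (Finset.mem_filter.1 h1).2
      have := (Finset.mem_filter.1 h2).2
      omega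
    · rw [Finset.disjoint_left]
      intro j h1 h2
      have := (Finset.mem_filter.1 h1).2
      rcases Finset.mem_union.1 h2 with h2 | h2 <;>
      · have := (Finset.mem_filter.1 h2).2
        omega
  rw [hsum, Nat.add_mul_div_left _ _ (by positivity), Nat.div_eq_of_lt hlow, zero_add,
    Nat.add_mul_mod_self_left, Nat.mod_eq_of_lt]
  rw [digitIndicator]
  split_ifs <;> omega

theorem baseDigits_mem_zeckendorfCollection_iff {N : ℕ} (hN : 2 ≤ N) {n : ℕ} :
    baseDigits N n ∈ zeckendorfCollection N ↔ ∃ s, NoRun N s ∧ ∑ k ∈ s, N ^ k = n := by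
  rw [mem_zeckendorfCollection_iff (by omega)]
  refine exists_congr fun s => and_congr_right fun _ => ?_
  rw [← baseDigits_sum_pow hN, (baseDigits_injective hN).eq_iff, eq_comm]

theorem zeckendorfCount_eq {N : ℕ} (hN : 2 ≤ N) (x : ℝ) :
    zeckendorfCount N x
      = Set.ncard {t : Finset ℕ | NoRun N t ∧ ((∑ k ∈ t, N ^ k : ℕ) : ℝ) < x} := by
  rw [zeckendorfCount, ← Set.ncard_image_of_injective _ (Finset.geomSum_injective hN)]
  congr 1
  ext n
  simp only [Set.mem_ofPred_eq, Set.mem_image, baseDigits_mem_zeckendorfCollection_iff hN]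
  constructor
  · rintro ⟨h, s, hs, rfl⟩
    exact ⟨s, ⟨hs, h⟩, rfl⟩
  · rintro ⟨s, ⟨hs, h⟩, rfl⟩
    exact ⟨h, s, hs, rfl⟩

theorem finite_geomSum_lt {N : ℕ} (hN : 2 ≤ N) (x : ℝ) :
    {t : Finset ℕ | ((∑ k ∈ t, N ^ k : ℕ) : ℝ) < x}.Finite := by
  have : {n : ℕ | (n : ℝ) < x}.Finite :=
    (Set.finite_lt_nat ⌈x⌉₊).subset fun n hn => Nat.lt_ceil.2 hn
  exact this.preimage (Finset.geomSum_injective hN).injOn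

/-- The count below a Zeckendorf expression is the sum of the counts over its digits. -/
theorem zeckendorfCount_geomSum {N : ℕ} (hN : 2 ≤ N) {s : Finset ℕ} (hs : NoRun N s) :
    zeckendorfCount N ((∑ k ∈ s, N ^ k : ℕ) : ℝ) = ∑ k ∈ s, (noRunSets N k).card := by
  rw [zeckendorfCount_eq hN, ← ncard_noRun_lt hN hs]
  simp only [Nat.cast_lt]

/-- Bounding the count by its value at the next Zeckendorf expression. -/
theorem exists_le_zeckendorfCount_eq {N : ℕ} (hN : 2 ≤ N) (x : ℝ) :
    ∃ s, NoRun N s ∧ x ≤ ((∑ k ∈ s, N ^ k : ℕ) : ℝ) ∧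
      zeckendorfCount N x = ∑ k ∈ s, (noRunSets N k).card := by
  classical
  have hex : ∃ n : ℕ, x ≤ n ∧ ∃ s, NoRun N s ∧ ∑ k ∈ s, N ^ k = n := by
    refine ⟨N ^ ⌈x⌉₊, ?_, {⌈x⌉₊}, noRun_of_card_lt (by simp; omega), by simp⟩
    exact (Nat.le_ceil x).trans (by exact_mod_cast (Nat.lt_pow_self (by omega)).le)
  obtain ⟨hx, s, hs, hsn⟩ := Nat.find_spec hex
  refine ⟨s, hs, by rw [hsn]; exact hx, ?_⟩
  rw [← zeckendorfCount_geomSum hN hs, zeckendorfCount_eq hN, zeckendorfCount_eq hN]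
  congr 1
  ext t
  simp only [Set.mem_ofPred_eq]
  refine and_congr_right fun ht => ⟨fun h => ?_, fun h => ?_⟩
  · rw [hsn]; exact h.trans_le hx
  · by_contra! hc
    rw [hsn, Nat.cast_lt] at h
    exact Nat.find_min hex h ⟨hc, t, ht, rfl⟩

/-- Bounding the count by its value at the previous Zeckendorf expression. -/
theorem exists_zeckendorfCount_le_add_one {N : ℕ} (hN : 2 ≤ N) {x : ℝ} (hx : 0 < x) :
    ∃ s, NoRun N s ∧ ((∑ k ∈ s, N ^ k : ℕ) : ℝ) ≤ x ∧
      zeckendorfCount N x ≤ ∑ k ∈ s, (noRunSets N k).card + 1 := by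
  classical
  have hfin : {t : Finset ℕ | NoRun N t ∧ ((∑ k ∈ t, N ^ k : ℕ) : ℝ) < x}.Finite :=
    (finite_geomSum_lt hN x).subset fun t ht => ht.2
  obtain ⟨s, ⟨hs, hsx⟩, hmax⟩ := Set.exists_max_image _ (fun t : Finset ℕ => ∑ k ∈ t, N ^ k) hfin
    ⟨∅, noRun_empty (by omega), by simpa using hx⟩
  refine ⟨s, hs, hsx.le, ?_⟩
  rw [← ncard_noRun_lt hN hs, zeckendorfCount_eq hN]
  -- The extra `1` accounts for `s` itself, the largest expression below `x`.
  refine (Set.ncard_le_ncard (t := insert s {t : Finset ℕ | NoRun N t ∧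
    ∑ k ∈ t, N ^ k < ∑ k ∈ s, N ^ k}) ?_ ?_).trans (Set.ncard_insert_le _ _)
  · intro t ht
    rcases (hmax t ht).lt_or_eq with h | h
    · exact Or.inr ⟨ht.1, h⟩
    · exact Or.inl (Finset.geomSum_injective hN h)
  · refine Set.Finite.insert _ (hfin.subset fun t ht => ⟨ht.1, lt_trans ?_ hsx⟩)
    exact_mod_cast ht.2

theorem card_noRunSets_le_zeckendorfCount {N m : ℕ} (hN : 2 ≤ N) {x : ℝ}
    (h : ∀ s ∈ noRunSets N m, ((∑ k ∈ s, N ^ k : ℕ) : ℝ) < x) :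
    (noRunSets N m).card ≤ zeckendorfCount N x := by
  rw [zeckendorfCount_eq hN, ← Set.ncard_coe_finset]
  exact Set.ncard_le_ncard (fun t ht => ⟨(mem_noRunSets.1 ht).2, h t ht⟩)
    ((finite_geomSum_lt hN x).subset fun t ht => ht.2)

theorem zeckendorfCount_pow {N : ℕ} (hN : 2 ≤ N) (m : ℕ) :
    zeckendorfCount N ((N ^ m : ℕ) : ℝ) = (noRunSets N m).card := by
  simpa using zeckendorfCount_geomSum hN (s := {m}) (noRun_of_card_lt (by simp; omega))

/-! ### The positive root of the `N`-step polynomial. -/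

theorem nStepPoly_eval (N : ℕ) (x : ℝ) :
    (nStepPoly N).eval x = x ^ N - ∑ k ∈ Finset.range N, x ^ k := by
  simp [nStepPoly, eval_finsetSum]

theorem nStepPoly_eval_two (N : ℕ) : (nStepPoly N).eval 2 = 1 := by
  rw [nStepPoly_eval, geom_sum_eq (by norm_num)]
  ring

section Root

variable {N : ℕ} {φ : ℝ}

theorem pow_eq_sum_of_root (h : (nStepPoly N).eval φ = 0) :
    φ ^ N = ∑ k ∈ Finset.range N, φ ^ k := by
  rw [nStepPoly_eval] at h
  linarith

theorem one_lt_of_root (hN : 2 ≤ N) (hφ : 0 < φ) (h : φ ^ N = ∑ k ∈ Finset.range N, φ ^ k) :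
    1 < φ := by
  by_contra! hle
  have h1 : φ ^ N ≤ 1 := pow_le_one₀ hφ.le hle
  have h2 : ∑ k ∈ Finset.range 2, φ ^ k ≤ ∑ k ∈ Finset.range N, φ ^ k :=
    Finset.sum_le_sum_of_subset_of_nonneg (Finset.range_subset_range.2 hN)
      fun k _ _ => by positivity
  simp [Finset.sum_range_succ] at h2
  linarith

theorem pow_mul_two_sub_of_root (h : φ ^ N = ∑ k ∈ Finset.range N, φ ^ k) :
    φ ^ N * (2 - φ) = 1 := by
  have := geom_sum_mul φ N
  rw [← h] at this
  linarith

theorem lt_two_of_root (hφ : 0 < φ) (h : φ ^ N = ∑ k ∈ Finset.range N, φ ^ k) : φ < 2 := by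
  have h1 := pow_mul_two_sub_of_root h
  have h2 : 0 < φ ^ N := by positivity
  by_contra! hc
  nlinarith

end Root

/-! ### Asymptotics of the `N`-step recurrence. -/

/-- A sequence whose terms are fixed convex combinations, with positive weights, of the preceding
`N` terms converges. -/
theorem exists_tendsto_of_convex_recurrence {N : ℕ} (hN : 0 < N) {w : ℕ → ℝ} {δ : ℝ}
    (hδ : 0 < δ) (hw : ∀ i < N, δ ≤ w i) (hw1 : ∑ i ∈ Finset.range N, w i = 1) {h : ℕ → ℝ}
    (hrec : ∀ k, h (k + N) = ∑ i ∈ Finset.range N, w i * h (k + i)) :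
    ∃ l, Tendsto h atTop (nhds l) := by
  have hne : (Finset.range N).Nonempty := Finset.nonempty_range_iff.2 hN.ne'
  -- Maximum and minimum over a window of length `N` are monotone in `k`; it remains to show that
  -- their limits agree.
  set M : ℕ → ℝ := fun k => (Finset.range N).sup' hne fun i => h (k + i) with hM
  set m : ℕ → ℝ := fun k => (Finset.range N).inf' hne fun i => h (k + i) with hm
  have leM : ∀ k i, i < N → h (k + i) ≤ M k := fun k i hi =>
    Finset.le_sup' (fun i => h (k + i)) (Finset.mem_range.2 hi)
  have mle : ∀ k i, i < N → m k ≤ h (k + i) := fun k i hi =>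
    Finset.inf'_le (fun i => h (k + i)) (Finset.mem_range.2 hi)
  -- The minimal term of the window carries weight at least `δ`.
  have up : ∀ k, h (k + N) ≤ (1 - δ) * M k + δ * m k := by
    intro k
    obtain ⟨i₀, hi₀, hmin⟩ := Finset.exists_mem_eq_inf' hne fun i => h (k + i)
    have h1 : w i₀ * (M k - h (k + i₀)) ≤
        ∑ i ∈ Finset.range N, w i * (M k - h (k + i)) :=
      Finset.single_le_sum (f := fun i => w i * (M k - h (k + i))) (fun i hi =>
        mul_nonneg (hδ.le.trans (hw i (Finset.mem_range.1 hi)))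
          (sub_nonneg.2 (leM k i (Finset.mem_range.1 hi)))) hi₀
    have h2 : ∑ i ∈ Finset.range N, w i * (M k - h (k + i)) = M k - h (k + N) := by
      simp only [mul_sub, Finset.sum_sub_distrib, ← Finset.sum_mul, hw1, one_mul, hrec]
    have h3 : h (k + i₀) = m k := hmin.symm
    have h4 : m k ≤ M k := (mle k 0 hN).trans (leM k 0 hN)
    rw [h2, h3] at h1
    nlinarith [hw i₀ (Finset.mem_range.1 hi₀)]
  have down : ∀ k, m k ≤ h (k + N) := by
    intro k
    have h2 : ∑ i ∈ Finset.range N, w i * (h (k + i) - m k) = h (k + N) - m k := by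
      simp only [mul_sub, Finset.sum_sub_distrib, ← Finset.sum_mul, hw1, one_mul, hrec]
    have h1 : 0 ≤ ∑ i ∈ Finset.range N, w i * (h (k + i) - m k) :=
      Finset.sum_nonneg fun i hi => mul_nonneg (hδ.le.trans (hw i (Finset.mem_range.1 hi)))
        (sub_nonneg.2 (mle k i (Finset.mem_range.1 hi)))
    linarith
  have Manti : Antitone M := by
    refine antitone_nat_of_succ_le fun k => Finset.sup'_le _ _ fun i hi => ?_
    rcases Nat.lt_or_ge (i + 1) N with hi' | hi'
    · have := leM k (i + 1) hi'
      rwa [show k + (i + 1) = k + 1 + i by omega] at this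
    · have hiN : i + 1 = N := by have := Finset.mem_range.1 hi; omega
      have h4 : m k ≤ M k := (mle k 0 hN).trans (leM k 0 hN)
      have := up k
      rw [show k + 1 + i = k + N by omega]
      nlinarith
  have mmono : Monotone m := by
    refine monotone_nat_of_le_succ fun k => Finset.le_inf' _ _ fun i hi => ?_
    rcases Nat.lt_or_ge (i + 1) N with hi' | hi'
    · have := mle k (i + 1) hi'
      rwa [show k + (i + 1) = k + 1 + i by omega] at this
    · have hiN : i + 1 = N := by have := Finset.mem_range.1 hi; omega
      rw [show k + 1 + i = k + N by omega]
      exact down k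
  have hmM : ∀ k, m k ≤ M k := fun k => (mle k 0 hN).trans (leM k 0 hN)
  have hMlim := tendsto_atTop_ciInf Manti
    ⟨m 0, by rintro _ ⟨k, rfl⟩; exact (mmono (Nat.zero_le k)).trans (hmM k)⟩
  have hmlim := tendsto_atTop_ciSup mmono
    ⟨M 0, by rintro _ ⟨k, rfl⟩; exact (hmM k).trans (Manti (Nat.zero_le k))⟩
  set Ms := ⨅ k, M k
  set ms := ⨆ k, m k
  have step : ∀ k, M (k + N) ≤ (1 - δ) * M k + δ * m (k + N) := by
    intro k
    refine Finset.sup'_le _ _ fun i hi => ?_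
    have hiN := Finset.mem_range.1 hi
    have h1 := up (k + i)
    rw [show k + i + N = k + N + i by omega] at h1
    have h2 : M (k + i) ≤ M k := Manti (Nat.le_add_right k i)
    have h3 : m (k + i) ≤ m (k + N) := mmono (by omega)
    have hδ1 : δ ≤ 1 := by
      rw [← hw1]
      exact (hw 0 hN).trans (Finset.single_le_sum (f := w) (fun i hi =>
        hδ.le.trans (hw i (Finset.mem_range.1 hi))) (Finset.mem_range.2 hN))
    nlinarith
  have hlim : Ms ≤ (1 - δ) * Ms + δ * ms :=
    le_of_tendsto_of_tendsto' ((tendsto_add_atTop_iff_nat N).2 hMlim)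
      ((hMlim.const_mul _).add (((tendsto_add_atTop_iff_nat N).2 hmlim).const_mul _)) step
  have hle : Ms ≤ ms := by nlinarith
  have hge : ms ≤ Ms := le_of_tendsto_of_tendsto' hmlim hMlim hmM
  have heq : ms = Ms := le_antisymm hge hle
  refine ⟨Ms, tendsto_of_tendsto_of_tendsto_of_le_of_le (heq ▸ hmlim) hMlim
    (fun k => by simpa using mle k 0 hN) (fun k => by simpa using leM k 0 hN)⟩

/-- The functional on polynomials that sends `X ^ i` to `H (k + i)`. -/
noncomputable def shiftFunctional (H : ℕ → ℝ) (k : ℕ) : ℝ[X] →ₗ[ℝ] ℝ :=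
  Polynomial.lsum fun i => LinearMap.mulRight ℝ (H (k + i))

theorem shiftFunctional_apply (H : ℕ → ℝ) (k : ℕ) (p : ℝ[X]) :
    shiftFunctional H k p = p.sum fun i a => a * H (k + i) := rfl

theorem shiftFunctional_monomial (H : ℕ → ℝ) (k i : ℕ) (a : ℝ) :
    shiftFunctional H k (monomial i a) = a * H (k + i) := by
  rw [shiftFunctional_apply, sum_monomial_index _ _ (by simp)]

theorem shiftFunctional_X_mul (H : ℕ → ℝ) (k : ℕ) (p : ℝ[X]) :
    shiftFunctional H k (X * p) = shiftFunctional H (k + 1) p := by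
  induction p using Polynomial.induction_on' with
  | add p q hp hq => rw [mul_add, map_add, map_add, hp, hq]
  | monomial n a =>
    rw [X_mul_monomial, shiftFunctional_monomial, shiftFunctional_monomial]
    congr 2; omega

theorem shiftFunctional_nStepPoly {N : ℕ} {H : ℕ → ℝ}
    (hH : ∀ k, H (k + N) = ∑ i ∈ Finset.range N, H (k + i)) (k : ℕ) :
    shiftFunctional H k (nStepPoly N) = 0 := by
  simp only [nStepPoly, map_sub, map_sum, ← monomial_one_right_eq_X_pow,
    shiftFunctional_monomial, one_mul, hH, sub_self]

theorem nStepPoly_monic {N : ℕ} (hN : 0 < N) :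
    (nStepPoly N).Monic ∧ (nStepPoly N).natDegree = N := by
  have hlt : (∑ k ∈ Finset.range N, (X : ℝ[X]) ^ k).degree < (N : ℕ) := by
    refine (degree_sum_le _ _).trans_lt ((Finset.sup_lt_iff (by simp)).2 fun k hk => ?_)
    rw [degree_X_pow]
    exact_mod_cast Finset.mem_range.1 hk
  refine ⟨monic_X_pow_sub hlt, ?_⟩
  rw [nStepPoly, natDegree_sub_eq_left_of_natDegree_lt, natDegree_X_pow]
  rw [natDegree_X_pow]
  by_cases h0 : (∑ k ∈ Finset.range N, (X : ℝ[X]) ^ k) = 0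
  · rw [h0]; simpa using hN
  · exact (natDegree_lt_iff_degree_lt h0).2 hlt

/-- Asymptotics of the sequence with the `N`-step recurrence and initial values `2 ^ k`. -/
theorem tendsto_nStep_div_pow {N : ℕ} (hN : 2 ≤ N) {φ : ℝ} (hφ : 0 < φ)
    (hroot : (nStepPoly N).eval φ = 0) {H : ℕ → ℝ} (hpos : ∀ k, 0 ≤ H k)
    (hinit : ∀ k < N, H k = 2 ^ k)
    (hrec : ∀ k, H (k + N) = ∑ i ∈ Finset.range N, H (k + i)) :
    0 < 1 / ((2 - φ) * (derivative (nStepPoly N)).eval φ) ∧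
    Tendsto (fun k => H k / φ ^ k) atTop
      (nhds (1 / ((2 - φ) * (derivative (nStepPoly N)).eval φ))) := by
  have hsum := pow_eq_sum_of_root hroot
  have h1φ := one_lt_of_root hN hφ hsum
  have h2φ := lt_two_of_root hφ hsum
  obtain ⟨l, hl⟩ : ∃ l, Tendsto (fun k => H k / φ ^ k) atTop (nhds l) := by
    -- Dividing by `φ ^ k` turns the recurrence into an average: the root equation says that the
    -- weights `φ ^ i / φ ^ N` sum to `1`, and the smallest is the one at `i = 0`.
    refine exists_tendsto_of_convex_recurrence (N := N) (by omega)
      (w := fun i => φ ^ i / φ ^ N) (δ := 1 / φ ^ N) (by positivity) ?_ ?_ ?_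
    · intro i _
      gcongr
      exact one_le_pow₀ h1φ.le
    · rw [← Finset.sum_div, ← hsum, div_self (by positivity)]
    · intro k
      rw [hrec, Finset.sum_div]
      refine Finset.sum_congr rfl fun i _ => ?_
      field_simp
      ring
  obtain ⟨q, hq⟩ : (X - C φ) ∣ nStepPoly N := dvd_iff_isRoot.2 hroot
  obtain ⟨hmonic, hdeg⟩ := nStepPoly_monic (N := N) (by omega)
  have hq0 : q ≠ 0 := by
    rintro rfl
    rw [mul_zero] at hq
    exact hmonic.ne_zero hq
  have hqdeg : q.natDegree < N := by
    rw [hq, natDegree_mul (X_sub_C_ne_zero φ) hq0, natDegree_X_sub_C] at hdeg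
    omega
  have hder : (derivative (nStepPoly N)).eval φ = q.eval φ := by
    rw [hq]; simp
  have hq2 : (2 - φ) * q.eval 2 = 1 := by
    rw [← nStepPoly_eval_two N, hq]; simp
  -- Write the polynomial as `(X - φ) * q`. The functional kills it and turns multiplication by `X`
  -- into a shift, so its value on `q` is multiplied by `φ` at each step; it starts at `q.eval 2`
  -- because `H i = 2 ^ i` on the coefficients of `q`.
  have hstep : ∀ k, shiftFunctional H k q = φ ^ k * q.eval 2 := by
    intro k
    induction k with
    | zero =>
      rw [shiftFunctional_apply, Polynomial.sum_over_range' _ _ N hqdeg,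
        eval_eq_sum_range' hqdeg, pow_zero, one_mul]
      · refine Finset.sum_congr rfl fun i hi => ?_
        rw [zero_add, hinit i (Finset.mem_range.1 hi)]
      · simp
    | succ k ih =>
      have h0 := shiftFunctional_nStepPoly hrec k
      rw [hq, sub_mul, map_sub, shiftFunctional_X_mul, ← smul_eq_C_mul, map_smul, ih,
        smul_eq_mul] at h0
      rw [pow_succ]
      linarith
  have hconst : ∀ k, ∑ i ∈ Finset.range N, q.coeff i * φ ^ i * (H (k + i) / φ ^ (k + i))
      = q.eval 2 := by
    intro k
    have h0 := hstep k
    rw [shiftFunctional_apply, Polynomial.sum_over_range' _ _ N hqdeg] at h0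
    · rw [← mul_right_inj' (pow_pos hφ k).ne', ← h0, Finset.mul_sum]
      refine Finset.sum_congr rfl fun i _ => ?_
      field_simp
      ring
    · simp
  have hlim : Tendsto (fun k => ∑ i ∈ Finset.range N,
      q.coeff i * φ ^ i * (H (k + i) / φ ^ (k + i))) atTop
      (nhds (∑ i ∈ Finset.range N, q.coeff i * φ ^ i * l)) :=
    tendsto_finsetSum _ fun i _ => ((tendsto_add_atTop_iff_nat i).2 hl).const_mul _
  simp only [hconst, ← Finset.sum_mul, ← eval_eq_sum_range' hqdeg] at hlim
  -- This determines `l`, since `q.eval 2 = 1 / (2 - φ)` and `q.eval φ` is the derivative at `φ`.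
  have heq : q.eval 2 = q.eval φ * l := tendsto_nhds_unique tendsto_const_nhds hlim
  have hprod : (2 - φ) * q.eval φ * l = 1 := by rw [mul_assoc, ← heq, hq2]
  have hne : (2 - φ) * q.eval φ ≠ 0 := left_ne_zero_of_mul_eq_one hprod
  have hlval : l = 1 / ((2 - φ) * (derivative (nStepPoly N)).eval φ) := by
    rw [hder, eq_div_iff hne, mul_comm, hprod]
  rw [← hlval]
  refine ⟨lt_of_le_of_ne ?_ ?_, hl⟩
  · exact ge_of_tendsto' hl fun k => div_nonneg (hpos k) (by positivity)
  · rintro rfl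
    simp at hprod

/-! ### Extremal inequalities between sums of powers of `φ` and of `N`. -/

/-- A linear functional of the indicator of a set without runs is bounded by a potential `g` that
dominates every top run. The set may reach one position higher if that position belongs to it. -/
theorem NoRun.sum_le_of_potential {N Q : ℕ} {w g : ℕ → ℝ} (hg : 0 ≤ g (N - 1))
    (hstep : ∀ q i, i < N → q ≤ Q →
      ∑ l ∈ Finset.range i, w (q + 1 + l) + g q ≤ g (q + 1 + i)) (m : ℕ) :
    ∀ s : Finset ℕ, s ⊆ Finset.range m → NoRun N s →
      (m + N ≤ Q + 1 ∨ m + N ≤ Q + 2 ∧ 0 < m ∧ m - 1 ∈ s) →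
      ∑ k ∈ s, w (k + N) ≤ g (m + N) := by
  induction m using Nat.strong_induction_on with
  | _ m ih =>
  intro s hsm hs hm
  have hN : 0 < N := by
    obtain ⟨i, hi, -⟩ := hs 0
    omega
  rcases hs.exists_top_run hsm with ⟨hmN, rfl⟩ | ⟨q, i, hi, hmq, hqs, hsq⟩
  -- Indices are shifted by `N`, so `N - 1` stands for a virtual gap just below position `0`.
  · have := hstep (N - 1) m hmN (by omega)
    rw [show N - 1 + 1 + m = m + N by omega] at this
    refine le_trans (le_of_eq (Finset.sum_congr rfl fun l _ => ?_))
      (le_trans (le_add_of_nonneg_right hg) this)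
    congr 1; omega
  -- If the top position belongs to `s`, the largest gap is at most `m - 2`; this is what the second
  -- alternative gains.
  · have hqQ : q + N ≤ Q := by
      rcases hm with hm | ⟨hm, hm0, hms⟩
      · omega
      · have : q ≠ m - 1 := fun h => hqs (h ▸ hms)
        omega
    have hih := ih q (by omega) (s.filter (· < q))
      (fun k hk => Finset.mem_range.2 (Finset.mem_filter.1 hk).2)
      (hs.subset (Finset.filter_subset _ _)) (Or.inl (by omega))
    have hq := hstep (q + N) i hi hqQ
    rw [hsq, Finset.sum_union, Finset.sum_Ico_eq_sum_range]
    · rw [show m + N = q + N + 1 + i by omega]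
      refine le_trans ?_ hq
      rw [add_comm, show q + 1 + i - (q + 1) = i by omega]
      refine add_le_add (le_of_eq (Finset.sum_congr rfl fun l _ => ?_)) hih
      congr 1; omega
    · rw [Finset.disjoint_left]
      intro k h1 h2
      have := (Finset.mem_filter.1 h1).2
      have := (Finset.mem_Ico.1 h2).1
      omega

/-- The value of the `N`-adic fraction whose digits are the periodic sequence `1, …, 1, 0`. -/
noncomputable def maxFraction (N : ℕ) : ℝ := 1 / ((N : ℝ) - 1) - 1 / ((N : ℝ) ^ N - 1)

section MaxFraction

variable {N : ℕ}

theorem one_lt_cast_pow_self (hN : 2 ≤ N) : (1 : ℝ) < (N : ℝ) ^ N := by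
  have : (1 : ℝ) < N := by exact_mod_cast hN
  exact one_lt_pow₀ this (by omega)

theorem maxFraction_pos (hN : 2 ≤ N) : 0 < maxFraction N := by
  have h1 : (1 : ℝ) < N := by exact_mod_cast hN
  have h2 : (N : ℝ) < (N : ℝ) ^ N := lt_self_pow₀ h1 (by omega)
  rw [maxFraction, sub_pos]
  exact one_div_lt_one_div_of_lt (by linarith) (by linarith)

theorem maxFraction_mul_le_one (hN : 2 ≤ N) : maxFraction N * ((N : ℝ) - 1) ≤ 1 := by
  have h1 : (1 : ℝ) < N := by exact_mod_cast hN
  have h2 := one_lt_cast_pow_self hN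
  have h3 : 0 ≤ 1 / ((N : ℝ) ^ N - 1) := by
    apply one_div_nonneg.2; linarith
  have h4 : 1 / ((N : ℝ) - 1) * ((N : ℝ) - 1) = 1 := by
    field_simp [(by linarith : (N : ℝ) - 1 ≠ 0)]
  rw [maxFraction, sub_mul, h4]
  nlinarith

/-- The defect of the potential `maxFraction N * N ^ k` along a run of length `i`. -/
theorem maxFraction_defect (hN : 2 ≤ N) (i : ℕ) :
    maxFraction N * (N : ℝ) ^ (1 + i) - maxFraction N - ∑ l ∈ Finset.range i, (N : ℝ) ^ (1 + l)
      = ((N : ℝ) ^ N - (N : ℝ) ^ (1 + i)) / ((N : ℝ) ^ N - 1) := by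
  have h1 : (1 : ℝ) < N := by exact_mod_cast hN
  have h2 := one_lt_cast_pow_self hN
  have h3 : (N : ℝ) - 1 ≠ 0 := by linarith
  have h4 : (N : ℝ) ^ N - 1 ≠ 0 := by linarith
  simp only [pow_add, pow_one, ← Finset.mul_sum]
  rw [geom_sum_eq h1.ne', maxFraction]
  field_simp
  ring

/-- The defect of the potential `φ ^ k` along a run of length `i`. -/
theorem root_defect {φ : ℝ} (h1 : 1 < φ) (h : φ ^ N = ∑ k ∈ Finset.range N, φ ^ k) (i : ℕ) :
    φ ^ (1 + i) - 1 - ∑ l ∈ Finset.range i, φ ^ (1 + l)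
      = (φ ^ N - φ ^ (1 + i)) / (φ ^ N * (φ - 1)) := by
  have h2 := pow_mul_two_sub_of_root h
  have h3 : φ - 1 ≠ 0 := by linarith
  have h4 : φ ^ N ≠ 0 := by positivity
  simp only [pow_add, pow_one, ← Finset.mul_sum]
  rw [geom_sum_eq h1.ne']
  field_simp
  linear_combination (-φ * φ ^ i) * h2

theorem NoRun.sum_pow_le_maxFraction (hN : 2 ≤ N) {s : Finset ℕ} (hs : NoRun N s) {m : ℕ}
    (hm : s ⊆ Finset.range m) : ∑ k ∈ s, (N : ℝ) ^ k ≤ maxFraction N * (N : ℝ) ^ m := by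
  have h1 : (1 : ℝ) < N := by exact_mod_cast hN
  have hb := maxFraction_pos hN
  have := NoRun.sum_le_of_potential (N := N) (Q := m + N) (w := fun k => (N : ℝ) ^ k)
    (g := fun k => maxFraction N * (N : ℝ) ^ k) (by positivity) ?_ m s hm hs
    (Or.inl (by omega))
  · simp only [pow_add, ← Finset.sum_mul, ← mul_assoc] at this
    exact le_of_mul_le_mul_right this (by positivity)
  · intro q i hi _
    have hd := maxFraction_defect hN i
    have hd0 : 0 ≤ ((N : ℝ) ^ N - (N : ℝ) ^ (1 + i)) / ((N : ℝ) ^ N - 1) := by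
      apply div_nonneg
      · exact sub_nonneg.2 (pow_le_pow_right₀ h1.le (by omega))
      · linarith [one_lt_cast_pow_self hN]
    have hq : (0 : ℝ) < (N : ℝ) ^ q := by positivity
    simp only [add_assoc, pow_add _ q, ← Finset.mul_sum]
    nlinarith

/-- The linear upper bound for the sum of powers of `φ` over a set without runs in terms of its
base-`N` value. -/
theorem NoRun.sum_pow_root_le_linear (hN : 2 ≤ N) {φ c ρ : ℝ} (h1φ : 1 < φ) (h2φ : φ < 2)
    (hroot : φ ^ N = ∑ k ∈ Finset.range N, φ ^ k) (hc0 : 0 ≤ c) (hc1 : c ≤ 1)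
    (hρ : ∀ i < N, ((N : ℝ) ^ N - (N : ℝ) ^ (1 + i)) / ((N : ℝ) ^ N - 1)
      ≤ ρ * ((φ ^ N - φ ^ (1 + i)) / (φ ^ N * (φ - 1))))
    (hcρ : c * ρ * φ ^ 2 ≤ maxFraction N * (N : ℝ) ^ 2)
    {s : Finset ℕ} (hs : NoRun N s) {m : ℕ} (hm : s ⊆ Finset.range (m + 1)) (hms : m ∈ s) :
    (∑ k ∈ s, φ ^ k) / φ ^ (m + 1)
      ≤ 1 - c * (1 - (∑ k ∈ s, (N : ℝ) ^ k) / (maxFraction N * (N : ℝ) ^ (m + 1))) := by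
  have hN0 : (0 : ℝ) < N := by positivity
  have hNφ : φ ≤ N := h2φ.le.trans (by exact_mod_cast hN)
  have hb := maxFraction_pos hN
  set b := maxFraction N with hbdef
  have hφ : 0 < φ := by linarith
  set τ := φ / N with hτ
  have hτ0 : 0 < τ := by positivity
  have hτ1 : τ ≤ 1 := (div_le_one hN0).2 hNφ
  have hτN : ∀ k, τ ^ k * (N : ℝ) ^ k = φ ^ k := fun k => by
    rw [← mul_pow, hτ, div_mul_cancel₀ _ hN0.ne']
  -- Chosen so that `lam * b * N ^ k = c * φ ^ k` at the top index `k = m + 1 + N`.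
  set lam := c / b * τ ^ (m + 1 + N) with hlam
  have hlamN : ∀ k r, k + r = m + 1 + N → lam * (N : ℝ) ^ k = c / b * τ ^ r * φ ^ k := by
    intro k r hk
    rw [hlam, ← hk, pow_add, ← hτN k]; ring
  have key := NoRun.sum_le_of_potential (N := N) (Q := m + N - 1)
    (w := fun k => φ ^ k - lam * (N : ℝ) ^ k)
    (g := fun k => φ ^ k - lam * b * (N : ℝ) ^ k) ?_ ?_ (m + 1) s hm hs
    (Or.inr ⟨by omega, by omega, by simpa using hms⟩)
  · simp only [pow_add _ _ N, ← mul_assoc, Finset.sum_sub_distrib, ← Finset.sum_mul,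
      ← Finset.mul_sum] at key
    have e1 := hlamN (m + 1 + N) 0 (by omega)
    rw [pow_zero, mul_one, pow_add, pow_add φ] at e1
    have e2 : lam * (N : ℝ) ^ N = c / b * φ ^ (m + 1) * φ ^ N / (N : ℝ) ^ (m + 1) := by
      rw [eq_div_iff (by positivity)]; linarith
    have e3 : lam * b * (N : ℝ) ^ (m + 1) * (N : ℝ) ^ N = c * (φ ^ (m + 1) * φ ^ N) := by
      have : lam * b * (N : ℝ) ^ (m + 1) * (N : ℝ) ^ N
        = b * (lam * ((N : ℝ) ^ (m + 1) * (N : ℝ) ^ N)) := by ring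
      rw [this, e1]; field_simp
    have e4 : lam * (∑ k ∈ s, (N : ℝ) ^ k) * (N : ℝ) ^ N
        = c * ((∑ k ∈ s, (N : ℝ) ^ k) / (b * (N : ℝ) ^ (m + 1))) * (φ ^ (m + 1) * φ ^ N) := by
      have : lam * (∑ k ∈ s, (N : ℝ) ^ k) * (N : ℝ) ^ N
        = (lam * (N : ℝ) ^ N) * (∑ k ∈ s, (N : ℝ) ^ k) := by ring
      rw [this, e2]; field_simp
    rw [e3, e4] at key
    rw [div_le_iff₀ (by positivity)]
    have hp : 0 < φ ^ N := by positivity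
    refine le_of_mul_le_mul_right ?_ hp
    linarith
  · have := hlamN (N - 1) (m + 2) (by omega)
    have h2 : lam * b * (N : ℝ) ^ (N - 1) = c * τ ^ (m + 2) * φ ^ (N - 1) := by
      have : lam * b * (N : ℝ) ^ (N - 1) = b * (lam * (N : ℝ) ^ (N - 1)) := by ring
      rw [this, ‹lam * (N : ℝ) ^ (N - 1) = _›]; field_simp
    have h3 : c * τ ^ (m + 2) ≤ 1 :=
      mul_le_one₀ hc1 (by positivity) (pow_le_one₀ hτ0.le hτ1)
    have h4 : 0 < φ ^ (N - 1) := by positivity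
    simp only [h2]
    nlinarith
  · intro q i hi hq
    have hd := maxFraction_defect hN i
    have he := root_defect h1φ hroot i
    have hρi := hρ i hi
    rw [← hd, ← he, ← hbdef] at hρi
    have hlq : lam * (N : ℝ) ^ q = c / b * τ ^ (m + 1 + N - q) * φ ^ q := hlamN _ _ (by omega)
    -- The exponent is at least `2` because `m ∈ s` forbids a gap at the top; hence the squares in
    -- the hypothesis `hcρ`.
    have hτ2 : τ ^ (m + 1 + N - q) ≤ τ ^ 2 := pow_le_pow_of_le_one hτ0.le hτ1 (by omega)
    have he0 : 0 ≤ φ ^ (1 + i) - 1 - ∑ l ∈ Finset.range i, φ ^ (1 + l) := by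
      rw [he]
      have : 0 < φ - 1 := by linarith
      refine div_nonneg (sub_nonneg.2 (pow_le_pow_right₀ h1φ.le (by omega))) (by positivity)
    set e := φ ^ (1 + i) - 1 - ∑ l ∈ Finset.range i, φ ^ (1 + l) with hedef
    set d := b * (N : ℝ) ^ (1 + i) - b - ∑ l ∈ Finset.range i, (N : ℝ) ^ (1 + l) with hddef
    have hq0 : 0 < φ ^ q := by positivity
    have hcond : c / b * τ ^ 2 * (ρ * e) ≤ e := by
      have : c / b * τ ^ 2 * (ρ * e) = (c * ρ * φ ^ 2) / (b * (N : ℝ) ^ 2) * e := by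
        rw [hτ]; field_simp
      rw [this]
      exact mul_le_of_le_one_left he0 ((div_le_one (by positivity)).2 hcρ)
    have hd0 : 0 ≤ d := by
      rw [hd]
      refine div_nonneg (sub_nonneg.2 (pow_le_pow_right₀ (h1φ.le.trans hNφ) (by omega))) ?_
      linarith [one_lt_cast_pow_self hN]
    have hmain : lam * (N : ℝ) ^ q * d ≤ φ ^ q * e := by
      calc lam * (N : ℝ) ^ q * d = φ ^ q * (c / b * τ ^ (m + 1 + N - q) * d) := by rw [hlq]; ring
        _ ≤ φ ^ q * (c / b * τ ^ 2 * d) := by gcongr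
        _ ≤ φ ^ q * (c / b * τ ^ 2 * (ρ * e)) := by gcongr
        _ ≤ φ ^ q * e := by gcongr
    simp only [add_assoc, pow_add _ q, Finset.sum_sub_distrib, ← Finset.mul_sum]
    rw [hedef, hddef] at hmain
    nlinarith

/-- Comparing powers with rational exponents. -/
theorem le_rpow_of_pow_le {s y γ : ℝ} {p q : ℕ} (hq : q ≠ 0) (hs0 : 0 < s) (hs1 : s ≤ 1)
    (hy : 0 ≤ y) (hyq : y ^ q ≤ s ^ p) (hγ : γ * q ≤ p) : y ≤ s ^ γ := by
  refine (pow_le_pow_iff_left₀ hy (by positivity) hq).1 (hyq.trans ?_)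
  rw [← Real.rpow_natCast (s ^ γ), ← Real.rpow_mul hs0.le, ← Real.rpow_natCast s]
  exact Real.rpow_le_rpow_of_exponent_ge hs0 hs1 hγ

theorem mul_le_of_rpow_pow_le {x γ : ℝ} {p q : ℕ} (hx : 1 < x) (h : (x ^ γ) ^ q ≤ x ^ p) :
    γ * q ≤ p := by
  rw [← Real.rpow_natCast (x ^ γ), ← Real.rpow_mul (by linarith), ← Real.rpow_natCast x] at h
  exact (Real.rpow_le_rpow_left_iff hx).1 h

/-- Existence of a chord below the power function whose slope is admissible for the linear bound. -/
theorem exists_admissible_slope (hN : 2 ≤ N) {φ γ : ℝ} (h1φ : 1 < φ) (h2φ : φ < 2)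
    (hroot : φ ^ N = ∑ k ∈ Finset.range N, φ ^ k) (hγ : (N : ℝ) ^ γ = φ) :
    ∃ c ρ : ℝ, 0 ≤ c ∧ c ≤ 1 ∧
      (∀ i < N, ((N : ℝ) ^ N - (N : ℝ) ^ (1 + i)) / ((N : ℝ) ^ N - 1)
        ≤ ρ * ((φ ^ N - φ ^ (1 + i)) / (φ ^ N * (φ - 1)))) ∧
      c * ρ * φ ^ 2 ≤ maxFraction N * (N : ℝ) ^ 2 ∧
      ∀ s : ℝ, ((N : ℝ) - 1) / N ≤ s → s ≤ 1 → 1 - c * (1 - s) ≤ s ^ γ := by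
  have hφ0 : φ ≠ 0 := by linarith
  have hφ1 : φ - 1 ≠ 0 := by linarith
  have hN1 : (1 : ℝ) < N := by exact_mod_cast hN
  -- A larger `c` lowers the chord but tightens the bound on `c * ρ * φ ^ 2`; the choices `9/10`,
  -- `3/4`, `3/5` satisfy both. The power `s ^ γ` is replaced by `s ^ (3/4)`, `s ^ (2/3)`, `s ^
  -- (1/2)` respectively, as `γ` is at most that exponent. For `N = 2, 3`, `ρ` is the exact ratio of
  -- defects at `i = N - 2`.
  obtain rfl | rfl | hN4 : N = 2 ∨ N = 3 ∨ 4 ≤ N := by omega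
  · have hφ2 : φ ^ 2 = 1 + φ := by simpa [Finset.sum_range_succ] using hroot
    have hφ3 : φ ^ 3 = 1 + 2 * φ := by linear_combination (φ + 1) * hφ2
    have hlt : φ < 17 / 10 := by nlinarith
    refine ⟨9 / 10, 2 / 3 * φ, by norm_num, by norm_num, ?_, ?_, ?_⟩
    · intro i hi
      interval_cases i
      · have : (φ ^ 2 - φ ^ (1 + 0)) / (φ ^ 2 * (φ - 1)) = 1 / φ := by field_simp; ring
        rw [this]
        field_simp
        norm_num
      · norm_num
    · norm_num [maxFraction]
      linarith
    · intro s hs0 hs1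
      norm_num at hs0
      refine le_rpow_of_pow_le (p := 3) (q := 4) (by norm_num) (by linarith) hs1 (by linarith) ?_
        (mul_le_of_rpow_pow_le hN1 ?_)
      -- The cofactor of `1 - s` in `10000 * s ^ 3 - (1 + 9 * s) ^ 4`.
      · have hQ : 0 ≤ 6561 * s ^ 3 - 523 * s ^ 2 - 37 * s - 1 := by
          nlinarith [mul_nonneg (sq_nonneg s) (sub_nonneg.2 hs0)]
        have := mul_nonneg (sub_nonneg.2 hs1) hQ
        linear_combination this / 10000
      · rw [hγ]
        norm_num
        nlinarith
  · refine ⟨3 / 4, 9 / 13 * φ, by norm_num, by norm_num, ?_, ?_, ?_⟩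
    · intro i hi
      interval_cases i
      · have : (φ ^ 3 - φ ^ (1 + 0)) / (φ ^ 3 * (φ - 1)) = (φ + 1) / φ ^ 2 := by
          field_simp; ring
        rw [this]
        have : 9 / 13 * φ * ((φ + 1) / φ ^ 2) = 9 / 13 * ((φ + 1) / φ) := by field_simp
        rw [this]
        have : 3 / 2 ≤ (φ + 1) / φ := by
          rw [le_div_iff₀ (by linarith)]; linarith
        norm_num
        linarith
      · have : (φ ^ 3 - φ ^ (1 + 1)) / (φ ^ 3 * (φ - 1)) = 1 / φ := by field_simp; ring
        rw [this]
        field_simp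
        norm_num
      · norm_num
    · have h3 : φ ^ 3 ≤ 2 ^ 3 := pow_le_pow_left₀ (by linarith) h2φ.le 3
      norm_num [maxFraction]
      linarith
    · intro s hs0 hs1
      norm_num at hs0
      refine le_rpow_of_pow_le (p := 2) (q := 3) (by norm_num) (by linarith) hs1 (by linarith) ?_
        (mul_le_of_rpow_pow_le hN1 ?_)
      · have hQ : 0 ≤ 27 * s ^ 2 - 10 * s - 1 := by nlinarith
        have := mul_nonneg (sub_nonneg.2 hs1) hQ
        linear_combination this / 64
      · rw [hγ]
        have h3 : φ ^ 3 ≤ 2 ^ 3 := pow_le_pow_left₀ (by linarith) h2φ.le 3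
        norm_num
        linarith
  · have hN4' : (4 : ℝ) ≤ N := by exact_mod_cast hN4
    have hφN := pow_pos (by linarith : 0 < φ)
    refine ⟨3 / 5, φ, by norm_num, by norm_num, ?_, ?_, ?_⟩
    · intro i hi
      rcases Nat.lt_or_ge (1 + i) N with hi' | hi'
      · have hone : (1 : ℝ) ≤ (N : ℝ) ^ (1 + i) := one_le_pow₀ hN1.le
        have hgt := one_lt_cast_pow_self hN
        refine ((div_le_one (by linarith)).2 (by linarith)).trans ?_
        obtain ⟨M, rfl⟩ : ∃ M, N = M + 1 := ⟨N - 1, by omega⟩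
        have hle : φ ^ (1 + i) ≤ φ ^ M := pow_le_pow_right₀ h1φ.le (by omega)
        rw [mul_div_assoc', le_div_iff₀ (mul_pos (hφN _) (by linarith)), pow_succ]
        nlinarith
      · have : 1 + i = N := by omega
        rw [this]; simp
    · have h3 : φ ^ 3 ≤ 2 ^ 3 := pow_le_pow_left₀ (by linarith) h2φ.le 3
      have hb : (N : ℝ) + 1 ≤ maxFraction N * (N : ℝ) ^ 2 := by
        have h4 : (N : ℝ) ^ 3 ≤ (N : ℝ) ^ N := pow_le_pow_right₀ hN1.le (by omega)
        have h5 : 1 / ((N : ℝ) ^ N - 1) ≤ 1 / ((N : ℝ) ^ 2 * ((N : ℝ) - 1)) := by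
          apply one_div_le_one_div_of_le
          · have : (0 : ℝ) < N - 1 := by linarith
            positivity
          · nlinarith
        have h6 : ((N : ℝ) + 1) / (N : ℝ) ^ 2
            = 1 / ((N : ℝ) - 1) - 1 / ((N : ℝ) ^ 2 * ((N : ℝ) - 1)) := by
          have : (N : ℝ) - 1 ≠ 0 := by linarith
          field_simp
          ring
        rw [← div_le_iff₀ (by positivity), maxFraction]
        linarith
      nlinarith
    · intro s hs0 hs1
      have hs : 3 / 4 ≤ s := by
        refine le_trans ?_ hs0
        rw [le_div_iff₀ (by linarith)]; linarith
      refine le_rpow_of_pow_le (p := 1) (q := 2) (by norm_num) (by linarith) hs1 (by linarith) ?_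
        (mul_le_of_rpow_pow_le hN1 ?_)
      · have := mul_nonneg (sub_nonneg.2 hs1) (by linarith : 0 ≤ 9 * s - 4)
        linear_combination this / 25
      · rw [hγ]
        nlinarith

/-- The sharp upper bound for the sum of powers of `φ` over a set without runs. -/
theorem NoRun.sum_pow_root_le (hN : 2 ≤ N) {φ γ : ℝ} (h1φ : 1 < φ) (h2φ : φ < 2)
    (hroot : φ ^ N = ∑ k ∈ Finset.range N, φ ^ k) (hγ : (N : ℝ) ^ γ = φ) {s : Finset ℕ}
    (hs : NoRun N s) :
    ∑ k ∈ s, φ ^ k ≤ (∑ k ∈ s, (N : ℝ) ^ k) ^ γ / maxFraction N ^ γ := by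
  have hb := maxFraction_pos hN
  have hN0 : (0 : ℝ) < N := by positivity
  rcases s.eq_empty_or_nonempty with rfl | hne
  · simp only [Finset.sum_empty]
    positivity
  obtain ⟨c, ρ, hc0, hc1, hρ, hcρ, hchord⟩ := exists_admissible_slope hN h1φ h2φ hroot hγ
  set m := s.max' hne
  have hms : m ∈ s := s.max'_mem hne
  have hm : s ⊆ Finset.range (m + 1) := fun k hk =>
    Finset.mem_range.2 (Nat.lt_succ_of_le (s.le_max' k hk))
  have hlin := hs.sum_pow_root_le_linear hN h1φ h2φ hroot hc0 hc1 hρ hcρ hm hms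
  have hTle := hs.sum_pow_le_maxFraction hN hm
  have hTge : (N : ℝ) ^ m ≤ ∑ k ∈ s, (N : ℝ) ^ k :=
    Finset.single_le_sum (f := fun k => (N : ℝ) ^ k) (fun k _ => by positivity) hms
  set T := ∑ k ∈ s, (N : ℝ) ^ k
  have hD : 0 < maxFraction N * (N : ℝ) ^ (m + 1) := by positivity
  -- The top term alone gives `N ^ m ≤ T`, and `maxFraction N` is at most `1 / (N - 1)`.
  have hlow : ((N : ℝ) - 1) / N ≤ T / (maxFraction N * (N : ℝ) ^ (m + 1)) := by
    rw [div_le_div_iff₀ hN0 hD]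
    have h1 := maxFraction_mul_le_one hN
    have h2 : (0 : ℝ) < (N : ℝ) ^ (m + 1) := by positivity
    calc ((N : ℝ) - 1) * (maxFraction N * (N : ℝ) ^ (m + 1))
        = maxFraction N * ((N : ℝ) - 1) * (N : ℝ) ^ (m + 1) := by ring
      _ ≤ 1 * (N : ℝ) ^ (m + 1) := by gcongr
      _ = (N : ℝ) ^ m * N := by ring
      _ ≤ T * N := by gcongr
  have := hlin.trans (hchord _ hlow ((div_le_one hD).2 hTle))
  rw [div_le_iff₀ (by positivity)] at this
  refine this.trans (le_of_eq ?_)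
  have hT0 : 0 ≤ T := le_trans (by positivity) hTge
  have hpow : ((N : ℝ) ^ (m + 1)) ^ γ = φ ^ (m + 1) := by
    rw [← hγ, ← Real.rpow_natCast, ← Real.rpow_natCast, ← Real.rpow_mul hN0.le,
      ← Real.rpow_mul hN0.le, mul_comm]
  rw [Real.div_rpow hT0 hD.le, Real.mul_rpow hb.le (by positivity), hpow]
  have : 0 < maxFraction N ^ γ := by positivity
  field_simp

/-- The lower bound for the sum of powers of `φ` over a finite set. -/
theorem rpow_sum_pow_le (hN : 2 ≤ N) {φ γ : ℝ} (hγ : (N : ℝ) ^ γ = φ) (hγ0 : 0 < γ)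
    (hγ1 : γ ≤ 1) (s : Finset ℕ) :
    (∑ k ∈ s, (N : ℝ) ^ k) ^ γ ≤ ∑ k ∈ s, φ ^ k := by
  classical
  have hN0 : (0 : ℝ) < N := by positivity
  induction s using Finset.induction_on with
  | empty => simp [Real.zero_rpow hγ0.ne']
  | insert k s hk ih =>
    rw [Finset.sum_insert hk, Finset.sum_insert hk]
    have hpow : ((N : ℝ) ^ k) ^ γ = φ ^ k := by
      rw [← hγ, ← Real.rpow_natCast, ← Real.rpow_natCast, ← Real.rpow_mul hN0.le,
        ← Real.rpow_mul hN0.le, mul_comm]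
    have h1 : (0 : ℝ) ≤ (N : ℝ) ^ k := by positivity
    have h2 : (0 : ℝ) ≤ ∑ k ∈ s, (N : ℝ) ^ k := Finset.sum_nonneg fun k _ => by positivity
    -- Subadditivity of `t ^ γ` for `γ ≤ 1`.
    have := NNReal.coe_le_coe.2 (NNReal.rpow_add_le_add_rpow ⟨_, h1⟩ ⟨_, h2⟩ hγ0.le hγ1)
    rw [← hpow]
    exact le_trans (b := ((N : ℝ) ^ k) ^ γ + (∑ k ∈ s, (N : ℝ) ^ k) ^ γ) this
      (add_le_add_right ih _)

end MaxFraction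

/-! ### From the inequalities to upper and lower limits. -/

/-- The finitely many indices below `K`, where the asymptotic bound may fail, cost a constant
independent of `s`. -/
theorem sum_card_le {H : ℕ → ℝ} (hH : ∀ k, 0 ≤ H k) {φ a : ℝ} (hφ : 0 < φ) (ha : 0 ≤ a) {K : ℕ}
    (h : ∀ k ≥ K, H k ≤ a * φ ^ k) (s : Finset ℕ) :
    ∑ k ∈ s, H k ≤ a * ∑ k ∈ s, φ ^ k + ∑ k ∈ Finset.range K, H k := by
  classical
  rw [← Finset.sum_filter_add_sum_filter_not s (· < K), add_comm, Finset.mul_sum]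
  refine add_le_add ?_ ?_
  · refine (Finset.sum_le_sum fun k hk => h k (not_lt.1 (Finset.mem_filter.1 hk).2)).trans ?_
    exact Finset.sum_le_sum_of_subset_of_nonneg (Finset.filter_subset _ _)
      fun k _ _ => by positivity
  · exact Finset.sum_le_sum_of_subset_of_nonneg
      (fun k hk => Finset.mem_range.2 (Finset.mem_filter.1 hk).2) fun k _ _ => hH k

theorem le_sum_card {H : ℕ → ℝ} (hH : ∀ k, 0 ≤ H k) {φ a : ℝ} (hφ : 0 < φ) (ha : 0 ≤ a) {K : ℕ}
    (h : ∀ k ≥ K, a * φ ^ k ≤ H k) (s : Finset ℕ) :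
    a * ∑ k ∈ s, φ ^ k - ∑ k ∈ Finset.range K, a * φ ^ k ≤ ∑ k ∈ s, H k := by
  classical
  rw [sub_le_iff_le_add, Finset.mul_sum, ← Finset.sum_filter_add_sum_filter_not s (· < K),
    add_comm]
  refine add_le_add ?_ ?_
  · refine (Finset.sum_le_sum fun k hk => h k (not_lt.1 (Finset.mem_filter.1 hk).2)).trans ?_
    exact Finset.sum_le_sum_of_subset_of_nonneg (Finset.filter_subset _ _) fun k _ _ => hH k
  · exact Finset.sum_le_sum_of_subset_of_nonneg
      (fun k hk => Finset.mem_range.2 (Finset.mem_filter.1 hk).2) fun k _ _ => by positivity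

/-- The upper and lower limits of a function, over the reals and over the natural numbers,
from asymptotic bounds that are attained along sequences of natural numbers. -/
theorem limsup_liminf_eq_of_bounds {F : ℝ → ℝ} {U L : ℝ}
    (hU : ∀ ε > 0, ∀ᶠ x in atTop, F x ≤ U + ε) (hL : ∀ ε > 0, ∀ᶠ x in atTop, L - ε ≤ F x)
    {u v : ℕ → ℕ} (hu : Tendsto u atTop atTop) (hv : Tendsto v atTop atTop)
    (hFu : ∀ ε > 0, ∀ᶠ m in atTop, U - ε ≤ F (u m))
    (hFv : ∀ ε > 0, ∀ᶠ m in atTop, F (v m) ≤ L + ε) :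
    (limsup (fun x : ℝ => (F x : EReal)) atTop = (U : EReal) ∧
      liminf (fun x : ℝ => (F x : EReal)) atTop = (L : EReal)) ∧
    (limsup (fun x : ℕ => (F x : EReal)) atTop = (U : EReal) ∧
      liminf (fun x : ℕ => (F x : EReal)) atTop = (L : EReal)) := by
  have hcast : Tendsto (fun n : ℕ => (n : ℝ)) atTop atTop := tendsto_natCast_atTop_atTop
  have limU : Tendsto (fun m => (F (u m) : EReal)) atTop (nhds (U : EReal)) := by
    refine (continuous_coe_real_ereal.tendsto U).comp ?_
    rw [Metric.tendsto_atTop']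
    intro ε hε
    have h1 := (hcast.comp hu).eventually (hU (ε / 2) (by positivity))
    obtain ⟨n, hn⟩ := eventually_atTop.1 (h1.and (hFu (ε / 2) (by positivity)))
    refine ⟨n, fun m hm => ?_⟩
    obtain ⟨h2, h3⟩ := hn m hm.le
    simp only [Function.comp_apply] at h2
    rw [Real.dist_eq, abs_lt]
    constructor <;> linarith
  have limL : Tendsto (fun m => (F (v m) : EReal)) atTop (nhds (L : EReal)) := by
    refine (continuous_coe_real_ereal.tendsto L).comp ?_
    rw [Metric.tendsto_atTop']
    intro ε hε
    have h1 := (hcast.comp hv).eventually (hL (ε / 2) (by positivity))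
    obtain ⟨n, hn⟩ := eventually_atTop.1 (h1.and (hFv (ε / 2) (by positivity)))
    refine ⟨n, fun m hm => ?_⟩
    obtain ⟨h2, h3⟩ := hn m hm.le
    simp only [Function.comp_apply] at h2
    rw [Real.dist_eq, abs_lt]
    constructor <;> linarith
  -- Limits along naturals lie between those along reals and those along the extremal sequences, so
  -- each chain closes up.
  have a1 : (U : EReal) ≤ limsup (fun x : ℕ => (F x : EReal)) atTop := by
    rw [← limU.limsup_eq]
    exact hu.limsup_comp_le_limsup (u := fun x : ℕ => (F x : EReal))
  have a2 : limsup (fun x : ℕ => (F x : EReal)) atTop ≤ limsup (fun x : ℝ => (F x : EReal)) atTop :=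
    hcast.limsup_comp_le_limsup (u := fun x : ℝ => (F x : EReal))
  have a3 : limsup (fun x : ℝ => (F x : EReal)) atTop ≤ (U : EReal) := by
    refine EReal.le_of_forall_lt_iff_le.1 fun z hz => ?_
    have hz' : U < z := EReal.coe_lt_coe_iff.1 hz
    refine limsup_le_of_le (h := ?_)
    filter_upwards [hU (z - U) (by linarith)] with x hx
    exact EReal.coe_le_coe_iff.2 (by linarith)
  have b1 : liminf (fun x : ℕ => (F x : EReal)) atTop ≤ (L : EReal) := by
    rw [← limL.liminf_eq]
    exact hv.liminf_le_liminf_comp (u := fun x : ℕ => (F x : EReal))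
  have b2 : liminf (fun x : ℝ => (F x : EReal)) atTop ≤ liminf (fun x : ℕ => (F x : EReal)) atTop :=
    hcast.liminf_le_liminf_comp (u := fun x : ℝ => (F x : EReal))
  have b3 : (L : EReal) ≤ liminf (fun x : ℝ => (F x : EReal)) atTop := by
    refine EReal.ge_of_forall_gt_iff_ge.1 fun z hz => ?_
    have hz' : z < L := EReal.coe_lt_coe_iff.1 hz
    refine le_liminf_of_le (h := ?_)
    filter_upwards [hL (L - z) (by linarith)] with x hx
    exact EReal.coe_le_coe_iff.2 (by linarith)
  exact ⟨⟨le_antisymm a3 (a1.trans a2), le_antisymm (b2.trans b1) b3⟩,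
    le_antisymm (a2.trans a3) a1, le_antisymm b1 (b3.trans b2)⟩

section Count

variable {N : ℕ} {φ γ α : ℝ}

theorem eventually_bounds_of_tendsto_div {H : ℕ → ℝ} (hφ : 0 < φ)
    (h : Tendsto (fun k => H k / φ ^ k) atTop (nhds α)) {ε : ℝ} (hε : 0 < ε) :
    ∃ K, ∀ k ≥ K, (α - ε) * φ ^ k ≤ H k ∧ H k ≤ (α + ε) * φ ^ k := by
  obtain ⟨K, hK⟩ := Metric.tendsto_atTop.1 h ε hε
  refine ⟨K, fun k hk => ?_⟩
  have := hK k hk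
  rw [Real.dist_eq, abs_lt] at this
  have hp : 0 < φ ^ k := by positivity
  constructor
  · rw [← le_div_iff₀ hp]; linarith
  · rw [← div_le_iff₀ hp]; linarith

theorem zeckendorfCount_upper (hN : 2 ≤ N) (h1φ : 1 < φ) (h2φ : φ < 2)
    (hroot : φ ^ N = ∑ k ∈ Finset.range N, φ ^ k) (hγ : (N : ℝ) ^ γ = φ) (hγ0 : 0 < γ)
    (hα : 0 < α)
    (hlim : Tendsto (fun k => ((noRunSets N k).card : ℝ) / φ ^ k) atTop (nhds α))
    {ε : ℝ} (hε : 0 < ε) :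
    ∃ C, ∀ x : ℝ, 0 < x →
      (zeckendorfCount N x : ℝ) ≤ (α + ε) / maxFraction N ^ γ * x ^ γ + C := by
  have hφ : 0 < φ := by linarith
  have hb : 0 < maxFraction N ^ γ := Real.rpow_pos_of_pos (maxFraction_pos hN) _
  obtain ⟨K, hK⟩ := eventually_bounds_of_tendsto_div hφ hlim hε
  refine ⟨∑ k ∈ Finset.range K, ((noRunSets N k).card : ℝ) + 1, fun x hx => ?_⟩
  obtain ⟨s, hs, hsx, hz⟩ := exists_zeckendorfCount_le_add_one hN hx
  have hz' : (zeckendorfCount N x : ℝ) ≤ ∑ k ∈ s, ((noRunSets N k).card : ℝ) + 1 := by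
    exact_mod_cast hz
  have h1 := sum_card_le (fun k => Nat.cast_nonneg (noRunSets N k).card) hφ
    (by linarith : 0 ≤ α + ε) (fun k hk => (hK k hk).2) s
  have h2 := hs.sum_pow_root_le hN h1φ h2φ hroot hγ
  push_cast at hsx
  have h3 : (∑ k ∈ s, (N : ℝ) ^ k) ^ γ ≤ x ^ γ :=
    Real.rpow_le_rpow (Finset.sum_nonneg fun k _ => by positivity) hsx hγ0.le
  have h4 : (α + ε) * ∑ k ∈ s, φ ^ k ≤ (α + ε) / maxFraction N ^ γ * x ^ γ := by
    rw [div_mul_eq_mul_div, mul_div_assoc]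
    gcongr
    exact h2.trans (by gcongr)
  linarith

theorem zeckendorfCount_lower (hN : 2 ≤ N) (hφ : 0 < φ) (hγ : (N : ℝ) ^ γ = φ) (hγ0 : 0 < γ)
    (hγ1 : γ ≤ 1)
    (hlim : Tendsto (fun k => ((noRunSets N k).card : ℝ) / φ ^ k) atTop (nhds α))
    {ε : ℝ} (hε : 0 < ε) :
    ∃ C, ∀ x : ℝ, 0 < x → (α - ε) * x ^ γ - C ≤ (zeckendorfCount N x : ℝ) := by
  rcases le_or_gt (α - ε) 0 with hneg | hpos
  · refine ⟨0, fun x hx => ?_⟩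
    have h1 : 0 ≤ x ^ γ := by positivity
    have h2 : (0 : ℝ) ≤ zeckendorfCount N x := Nat.cast_nonneg _
    nlinarith
  obtain ⟨K, hK⟩ := eventually_bounds_of_tendsto_div hφ hlim hε
  refine ⟨∑ k ∈ Finset.range K, (α - ε) * φ ^ k, fun x hx => ?_⟩
  obtain ⟨s, hs, hsx, hz⟩ := exists_le_zeckendorfCount_eq hN x
  have hz' : (zeckendorfCount N x : ℝ) = ∑ k ∈ s, ((noRunSets N k).card : ℝ) := by
    exact_mod_cast hz
  have h1 := le_sum_card (fun k => Nat.cast_nonneg (noRunSets N k).card) hφ hpos.le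
    (fun k hk => (hK k hk).1) s
  have h2 := rpow_sum_pow_le hN hγ hγ0 hγ1 s
  push_cast at hsx
  have h3 : x ^ γ ≤ (∑ k ∈ s, (N : ℝ) ^ k) ^ γ := Real.rpow_le_rpow hx.le hsx hγ0.le
  have h4 : (α - ε) * x ^ γ ≤ (α - ε) * ∑ k ∈ s, φ ^ k := by
    gcongr
    exact h3.trans h2
  rw [hz']
  linarith

theorem zeckendorfCount_limits (hN : 2 ≤ N) (h1φ : 1 < φ) (h2φ : φ < 2)
    (hroot : φ ^ N = ∑ k ∈ Finset.range N, φ ^ k) (hγ : (N : ℝ) ^ γ = φ) (hγ0 : 0 < γ)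
    (hγ1 : γ ≤ 1) (hα : 0 < α)
    (hlim : Tendsto (fun k => ((noRunSets N k).card : ℝ) / φ ^ k) atTop (nhds α)) :
    (limsup (fun x : ℝ => (((zeckendorfCount N x : ℝ) / x ^ γ : ℝ) : EReal)) atTop
        = ((α / maxFraction N ^ γ : ℝ) : EReal) ∧
      liminf (fun x : ℝ => (((zeckendorfCount N x : ℝ) / x ^ γ : ℝ) : EReal)) atTop
        = (α : EReal)) ∧
    (limsup (fun x : ℕ => (((zeckendorfCount N x : ℝ) / (x : ℝ) ^ γ : ℝ) : EReal)) atTop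
        = ((α / maxFraction N ^ γ : ℝ) : EReal) ∧
      liminf (fun x : ℕ => (((zeckendorfCount N x : ℝ) / (x : ℝ) ^ γ : ℝ) : EReal)) atTop
        = (α : EReal)) := by
  have hφ : 0 < φ := by linarith
  have hN0 : (0 : ℝ) < N := by positivity
  have hN1 : (1 : ℝ) < N := by exact_mod_cast hN
  have hb0 := maxFraction_pos hN
  have hb : 0 < maxFraction N ^ γ := Real.rpow_pos_of_pos hb0 _
  have hpow : ∀ k : ℕ, ((N : ℝ) ^ k) ^ γ = φ ^ k := fun k => by
    rw [← hγ, ← Real.rpow_natCast, ← Real.rpow_natCast, ← Real.rpow_mul hN0.le,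
      ← Real.rpow_mul hN0.le, mul_comm]
  have hsmall : ∀ C ε : ℝ, 0 < ε → ∀ᶠ x : ℝ in atTop, C ≤ ε * x ^ γ := fun C ε hε =>
    ((tendsto_rpow_atTop hγ0).const_mul_atTop hε).eventually_ge_atTop C
  have hpowtop : Tendsto (fun m : ℕ => (N : ℝ) ^ m) atTop atTop :=
    tendsto_pow_atTop_atTop_of_one_lt hN1
  have hbtop : Tendsto (fun m : ℕ => maxFraction N * (N : ℝ) ^ m) atTop atTop :=
    hpowtop.const_mul_atTop hb0
  -- Every run-free set in `{0, …, m - 1}` has value below `u m`, so the count there is at least `H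
  -- m`; at `v m = N ^ m` it is exactly `H m`.
  refine limsup_liminf_eq_of_bounds (F := fun x : ℝ => (zeckendorfCount N x : ℝ) / x ^ γ)
    (u := fun m => ⌊maxFraction N * (N : ℝ) ^ m⌋₊ + 1) (v := fun m => N ^ m)
    ?_ ?_ ?_ ?_ ?_ ?_
  · intro ε hε
    obtain ⟨C, hC⟩ := zeckendorfCount_upper hN h1φ h2φ hroot hγ hγ0 hα hlim
      (ε := ε / 2 * maxFraction N ^ γ) (by positivity)
    filter_upwards [hsmall C (ε / 2) (by positivity), eventually_gt_atTop 0] with x hx hx0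
    rw [div_le_iff₀ (by positivity)]
    have := hC x hx0
    rw [add_div, mul_div_cancel_right₀ _ hb.ne'] at this
    linarith
  · intro ε hε
    obtain ⟨C, hC⟩ := zeckendorfCount_lower hN hφ hγ hγ0 hγ1 hlim (ε := ε / 2) (by positivity)
    filter_upwards [hsmall C (ε / 2) (by positivity), eventually_gt_atTop 0] with x hx hx0
    rw [le_div_iff₀ (by positivity)]
    have := hC x hx0
    linarith
  · exact tendsto_atTop_mono (fun m => Nat.le_succ _) (tendsto_nat_floor_atTop.comp hbtop)
  · exact tendsto_pow_atTop_atTop_of_one_lt (by omega)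
  · intro ε hε
    -- the ratio at the end of a maximal pattern
    have hlow : ∀ m : ℕ, ((noRunSets N m).card : ℝ) / φ ^ m /
        (maxFraction N + 1 / (N : ℝ) ^ m) ^ γ ≤
        (zeckendorfCount N ((⌊maxFraction N * (N : ℝ) ^ m⌋₊ + 1 : ℕ) : ℝ) : ℝ) /
          ((⌊maxFraction N * (N : ℝ) ^ m⌋₊ + 1 : ℕ) : ℝ) ^ γ := by
      intro m
      rw [div_div, ← hpow m, ← Real.mul_rpow (by positivity) (by positivity)]
      have hle : ((⌊maxFraction N * (N : ℝ) ^ m⌋₊ + 1 : ℕ) : ℝ)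
          ≤ (N : ℝ) ^ m * (maxFraction N + 1 / (N : ℝ) ^ m) := by
        rw [mul_add, mul_one_div_cancel (by positivity), mul_comm]
        push_cast
        gcongr
        exact Nat.floor_le (by positivity)
      have hcount : ((noRunSets N m).card : ℝ) ≤
          (zeckendorfCount N ((⌊maxFraction N * (N : ℝ) ^ m⌋₊ + 1 : ℕ) : ℝ) : ℝ) := by
        refine Nat.cast_le.2 (card_noRunSets_le_zeckendorfCount hN fun s hs => ?_)
        obtain ⟨h1, h2⟩ := mem_noRunSets.1 hs
        refine lt_of_le_of_lt ?_ (Nat.lt_succ_floor (maxFraction N * (N : ℝ) ^ m) |>.trans_eq ?_)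
        · push_cast
          exact h2.sum_pow_le_maxFraction hN h1
        · simp
      gcongr
    have hinv : Tendsto (fun m : ℕ => 1 / (N : ℝ) ^ m) atTop (nhds 0) := by
      simpa [Function.comp_def] using tendsto_inv_atTop_zero.comp hpowtop
    have hden : Tendsto (fun m : ℕ => (maxFraction N + 1 / (N : ℝ) ^ m) ^ γ) atTop
        (nhds (maxFraction N ^ γ)) := by
      have := (hinv.const_add (maxFraction N)).rpow_const (p := γ) (Or.inr hγ0.le)
      simpa using this
    have hl := hlim.div hden hb.ne'
    filter_upwards [hl.eventually_const_le (show α / maxFraction N ^ γ - ε < _ by linarith)] with m hm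
    exact hm.trans (hlow m)
  · intro ε hε
    filter_upwards [hlim.eventually_le_const (show α < α + ε by linarith)] with m hm
    rw [zeckendorfCount_pow hN, Nat.cast_pow, hpow]
    exact hm

end Count

/-! ### The main theorem and the golden ratio case. -/

theorem mainTheorem8 (N : ℕ) (hN : 2 ≤ N) (φ γ α P : ℝ)
    (hφ : IsDominantZero (nStepPoly N) φ)
    (hγ : γ = Real.logb N φ)
    (hα : α = (nStepPoly N).eval 2 / ((2 - φ) * (derivative (nStepPoly N)).eval φ))
    (hP : P = ((N : ℝ) ^ (N - 1) - 1) /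
      (((N : ℝ) - 1) * ((N : ℝ) ^ N - 1) * (N : ℝ) ^ (N - 1))) :
    -- `x` runs through the real numbers
    (limsup (fun x : ℝ => (((zeckendorfCount N x : ℝ) / x ^ γ : ℝ) : EReal)) atTop
        = ((α / (P ^ γ * φ ^ N) : ℝ) : EReal) ∧
      liminf (fun x : ℝ => (((zeckendorfCount N x : ℝ) / x ^ γ : ℝ) : EReal)) atTop
        = (α : EReal)) ∧
    -- `x` runs through the positive integers
    (limsup (fun x : ℕ => (((zeckendorfCount N x : ℝ) / (x : ℝ) ^ γ : ℝ) : EReal)) atTop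
        = ((α / (P ^ γ * φ ^ N) : ℝ) : EReal) ∧
      liminf (fun x : ℕ => (((zeckendorfCount N x : ℝ) / (x : ℝ) ^ γ : ℝ) : EReal)) atTop
        = (α : EReal)) ∧
    -- the values for `N = 2`
    (N = 2 → φ = Real.goldenRatio ∧
      α / (P ^ γ * φ ^ N) = (φ + 2) / 5 * (3 : ℝ) ^ γ ∧
      α = (3 * φ + 1) / 5) := by
  obtain ⟨hφ0, hzero, -⟩ := hφ
  have hroot := pow_eq_sum_of_root hzero
  have h1φ := one_lt_of_root hN hφ0 hroot
  have h2φ := lt_two_of_root hφ0 hroot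
  have hN1 : (1 : ℝ) < N := by exact_mod_cast hN
  have hN0 : (0 : ℝ) < N := by linarith
  have hpow1 := one_lt_cast_pow_self hN
  have hγφ : (N : ℝ) ^ γ = φ := by rw [hγ, Real.rpow_logb hN0 hN1.ne' hφ0]
  have hγ0 : 0 < γ := by rw [hγ]; exact Real.logb_pos hN1 h1φ
  have hγ1 : γ ≤ 1 := by
    rw [hγ, Real.logb_le_iff_le_rpow hN1 hφ0, Real.rpow_one]
    exact h2φ.le.trans (by exact_mod_cast hN)
  have hα' : α = 1 / ((2 - φ) * (derivative (nStepPoly N)).eval φ) := by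
    rw [hα, nStepPoly_eval_two]
  obtain ⟨hαpos, hlim⟩ := tendsto_nStep_div_pow hN hφ0 hzero
    (H := fun k => ((noRunSets N k).card : ℝ)) (fun k => Nat.cast_nonneg _)
    (fun k hk => by rw [card_noRunSets_of_lt hk]; norm_num)
    (fun k => by rw [card_noRunSets_add]; push_cast; rfl)
  rw [← hα'] at hαpos hlim
  have hPb : P * (N : ℝ) ^ N = maxFraction N := by
    have h1 : (N : ℝ) - 1 ≠ 0 := by linarith
    have h2 : (N : ℝ) ^ N - 1 ≠ 0 := by linarith
    obtain ⟨M, rfl⟩ : ∃ M, N = M + 1 := ⟨N - 1, by omega⟩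
    rw [hP, maxFraction, Nat.add_sub_cancel]
    rw [pow_succ] at h2 ⊢
    field_simp
    ring
  have hP0 : 0 ≤ P := by
    have := maxFraction_pos hN
    rw [← hPb] at this
    exact (pos_of_mul_pos_left this (by positivity)).le
  -- Since `φ ^ N = (N ^ N) ^ γ`, the two factors combine to `(P * N ^ N) ^ γ`.
  have hPφ : P ^ γ * φ ^ N = maxFraction N ^ γ := by
    rw [← hPb, Real.mul_rpow hP0 (by positivity), ← hγφ, ← Real.rpow_natCast,
      ← Real.rpow_natCast, ← Real.rpow_mul hN0.le, ← Real.rpow_mul hN0.le, mul_comm γ]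
  obtain ⟨hreal, hnat⟩ := zeckendorfCount_limits hN h1φ h2φ hroot hγφ hγ0 hγ1 hαpos hlim
  rw [hPφ]
  refine ⟨hreal, hnat, ?_⟩
  rintro rfl
  have hφ2 : φ ^ 2 = 1 + φ := by simpa [Finset.sum_range_succ] using hroot
  have hαval : α = (3 * φ + 1) / 5 := by
    have hder : (derivative (nStepPoly 2)).eval φ = 2 * φ - 1 := by
      norm_num [nStepPoly, Finset.sum_range_succ]
    rw [hα', hder, div_eq_div_iff (mul_pos (by linarith) (by linarith)).ne' (by norm_num)]
    linear_combination (6 * φ - 7) * hφ2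
  refine ⟨?_, ?_, hαval⟩
  · have h1 := Real.goldenRatio_sq
    have h2 := Real.goldenRatio_pos
    -- Both numbers solve `t ^ 2 = t + 1`; if distinct, they would sum to `1`, but both exceed `1`.
    have h3 : (φ - Real.goldenRatio) * (φ + Real.goldenRatio - 1) = 0 := by
      linear_combination hφ2 - h1
    rcases mul_eq_zero.1 h3 with h | h
    · linarith
    · have := Real.one_lt_goldenRatio
      linarith
  · have hmf : maxFraction 2 = 2 / 3 := by norm_num [maxFraction]
    have h3 : (0 : ℝ) < 3 ^ γ := by positivity
    have h2 : (2 : ℝ) ^ γ = φ := by exact_mod_cast hγφ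
    rw [hmf, Real.div_rpow (by norm_num) (by norm_num), h2, hαval]
    field_simp
    linear_combination (-1) * hφ2
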